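/- Let $n\ge 2$ and let $A\in\mathbb{R}^{n\times n}$ be symmetric positive definite with distinct eigenvalues $L=\lambda_1>\lambda_2>\cdots>\lambda_n=\mu>0$, $\Lambda=\mathrm{diag}(\lambda_1,\dots,\lambda_n)$, $A=Q\Lambda Q^{\top}$ with $Q$ orthogonal, and $\kappa=L/\mu$. Let $f(x)=\tfrac12\langle x,Ax\rangle$ and, for $x\neq 0$, $h_x(\alpha)=\dfrac{f(x-\alpha\nabla f(x))-f(x)}{\|\nabla f(x)\|^2}$. With scalar stepsizes and $\eta>0$, Classic-HDM iterates $\alpha_{k+1}=\alpha_k-\eta h_{x^k}'(\alpha_k)$, $x^{k+1}=x^k-\alpha_{k+1}\nabla f(x^k)$, and OSGM-H (without monotone landscape action) iterates $x^{k+1}=x^k-\alpha_k\nabla f(x^k)$, $\alpha_{k+1}=\alpha_k-\eta h_{x^k}'(\alpha_k)$. For $\alpha\in\mathbb{R}$ and $z\neq0$ put $$\alpha^+(z)=\alpha+\eta-\alpha\eta\,\frac{\langle z,\Lambda^3z\rangle}{\langle z,\Lambda^2z\rangle},\qquad \mathcal F_{\mathrm{HDM}}(\alpha,z)=\Big(\alpha^+(z),\tfrac{(I-\alpha^+(z)\Lambda)z}{\|(I-\alpha^+(z)\Lambda)z\|}\Big),\qquad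 \mathcal F_{\mathrm{OSGM}}(\alpha,z)=\Big(\alpha^+(z),\tfrac{(I-\alpha\Lambda)z}{\|(I-\alpha\Lambda)z\|}\Big)$$ (with $0/\|0\|:=0$), and let $\alpha^\star=\frac{2}{L+\mu}$, $\gamma=\frac{\mu}{\sqrt{L^2+\mu^2}}$, $\delta=\pm\frac{L}{\sqrt{L^2+\mu^2}}$ (either sign), $\hat z_1^\star=\gamma e_1+\delta e_n$, $\hat z_2^\star=-\gamma e_1+\delta e_n$. Then for every $\eta\in(0,\frac1L]$: 1. $\mathcal F_{\mathrm{HDM}}$ and $\mathcal F_{\mathrm{OSGM}}$ are the normalized dynamical systems of the two algorithms: whenever $x\neq0$, one iteration of Classic-HDM (resp. OSGM-H) takes $(\alpha,x)$ to some $(\alpha',x')$ such that $\mathcal F_{\mathrm{HDM}}$ (resp. $\mathcal F_{\mathrm{OSGM}}$) maps $(\alpha,\hat z)$ to $(\alpha',\hat z')$, where $\hat z=\frac{Q^\top x}{\|Q^\top x\|}$ and $\hat z'=\frac{Q^\top x'}{\|Q^\top x'\|}$. 2. Both systems, on the state space $\{(\alpha,z):\|z\|=1\}$, have the common period-2 orbit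 $\{(\alpha^\star,\hat z_1^\star),(\alpha^\star,\hat z_2^\star)\}$: the two points are distinct and each system interchanges them. 3. Both systems, as maps of $(\alpha,z)\in\mathbb{R}\times\mathbb{R}^n$, are differentiable at the two points, and their $(n+1)\times(n+1)$ Jacobian matrices $\mathcal J_{\mathrm{HDM}},\mathcal J_{\mathrm{OSGM}}$ satisfy $$\rho\big(\mathcal J_{\mathrm{HDM}}(\alpha^\star,\hat z_1^\star)\,\mathcal J_{\mathrm{HDM}}(\alpha^\star,\hat z_2^\star)\big)<1,\qquad \rho\big(\mathcal J_{\mathrm{OSGM}}(\alpha^\star,\hat z_1^\star)\,\mathcal J_{\mathrm{OSGM}}(\alpha^\star,\hat z_2^\star)\big)=1+\tfrac{\eta(L+\mu)}{2}>1,$$ where $\rho$ is the spectral radius (largest modulus of a complex eigenvalue). In particular, for $\eta=\frac1L$ the second spectral radius equals $\frac{3\kappa+1}{2\kappa}$. 4. Consequently, on the state space $\{(\alpha,z):\|z\|=1\}$, the orbit is (asymptotically) stable for $\mathcal F_{\mathrm{HDM}}$ and unstable (not Lyapunov stable) for $\mathcal F_{\mathrm{OSGM}}$. -/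

import Mathlib

open scoped Matrix Topology

noncomputable section

/-- The quadratic objective `f(x) = ½ ⟨x, A x⟩` on `ℝⁿ`. -/
def quadObjective {n : ℕ} (A : Matrix (Fin n) (Fin n) ℝ) (x : EuclideanSpace ℝ (Fin n)) : ℝ :=
  1 / 2 * inner ℝ x (Matrix.toEuclideanCLM (𝕜 := ℝ) A x)

/-- The hypergradient feedback `h_x(α) = (f(x - α ∇f(x)) - f(x)) / ‖∇f(x)‖²` with the scalar
stepsize `P = α I`. -/
def hypergradientFeedback {n : ℕ} (f : EuclideanSpace ℝ (Fin n) → ℝ)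
    (x : EuclideanSpace ℝ (Fin n)) (α : ℝ) : ℝ :=
  (f (x - α • gradient f x) - f x) / ‖gradient f x‖ ^ 2

/-- One iteration of Classic-HDM with scalar stepsize: the stepsize is updated first, and the new
stepsize is used in the gradient step. -/
def hdmStep {n : ℕ} (f : EuclideanSpace ℝ (Fin n) → ℝ) (η : ℝ)
    (s : ℝ × EuclideanSpace ℝ (Fin n)) : ℝ × EuclideanSpace ℝ (Fin n) :=
  (s.1 - η * deriv (hypergradientFeedback f s.2) s.1,
    s.2 - (s.1 - η * deriv (hypergradientFeedback f s.2) s.1) • gradient f s.2)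

/-- One iteration of OSGM-H with scalar stepsize (no monotone landscape action): the gradient step
uses the current stepsize. -/
def osgmStep {n : ℕ} (f : EuclideanSpace ℝ (Fin n) → ℝ) (η : ℝ)
    (s : ℝ × EuclideanSpace ℝ (Fin n)) : ℝ × EuclideanSpace ℝ (Fin n) :=
  (s.1 - η * deriv (hypergradientFeedback f s.2) s.1, s.2 - s.1 • gradient f s.2)

/-- The direction `z / ‖z‖`. -/
def direction {n : ℕ} (z : EuclideanSpace ℝ (Fin n)) : EuclideanSpace ℝ (Fin n) :=
  ‖z‖⁻¹ • z

/-- The normalized state `(α, z / ‖z‖)` of a stepsize `α` and an iterate `x`, where `z = Qᵀ x` are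
the coordinates of `x` in the basis formed by the columns of the orthogonal matrix `Q`. -/
def normalizedState {n : ℕ} (Q : Matrix (Fin n) (Fin n) ℝ)
    (s : ℝ × EuclideanSpace ℝ (Fin n)) : ℝ × EuclideanSpace ℝ (Fin n) :=
  (s.1, direction (Matrix.toEuclideanCLM (𝕜 := ℝ) Qᵀ s.2))

/-- The diagonal operator `Λ = diag(λ₁, …, λₙ)`. -/
def diagOp {n : ℕ} (lam : Fin n → ℝ) : EuclideanSpace ℝ (Fin n) →L[ℝ] EuclideanSpace ℝ (Fin n) :=
  Matrix.toEuclideanCLM (𝕜 := ℝ) (Matrix.diagonal lam)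

/-- The updated stepsize `α⁺(z) = α + η - α η ⟨z, Λ³ z⟩ / ⟨z, Λ² z⟩`. -/
def stepsizeUpdate {n : ℕ} (lam : Fin n → ℝ) (η α : ℝ) (z : EuclideanSpace ℝ (Fin n)) : ℝ :=
  α + η - α * η * (inner ℝ z ((diagOp lam ^ 3) z) / inner ℝ z ((diagOp lam ^ 2) z))

/-- The normalized dynamical system of Classic-HDM,
`(α, z) ↦ (α⁺(z), (I - α⁺(z) Λ) z / ‖(I - α⁺(z) Λ) z‖)`. -/
def hdmSystem {n : ℕ} (lam : Fin n → ℝ) (η : ℝ)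
    (s : ℝ × EuclideanSpace ℝ (Fin n)) : ℝ × EuclideanSpace ℝ (Fin n) :=
  (stepsizeUpdate lam η s.1 s.2,
    direction (s.2 - stepsizeUpdate lam η s.1 s.2 • diagOp lam s.2))

/-- The normalized dynamical system of OSGM-H,
`(α, z) ↦ (α⁺(z), (I - α Λ) z / ‖(I - α Λ) z‖)`. -/
def osgmSystem {n : ℕ} (lam : Fin n → ℝ) (η : ℝ)
    (s : ℝ × EuclideanSpace ℝ (Fin n)) : ℝ × EuclideanSpace ℝ (Fin n) :=
  (stepsizeUpdate lam η s.1 s.2, direction (s.2 - s.1 • diagOp lam s.2))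

/-- The `(n+1) × (n+1)` Jacobian matrix of a map of `(α, z) ∈ ℝ × ℝⁿ`, in the standard basis. -/
def jacobianMatrix {n : ℕ}
    (F : ℝ × EuclideanSpace ℝ (Fin n) → ℝ × EuclideanSpace ℝ (Fin n))
    (s : ℝ × EuclideanSpace ℝ (Fin n)) : Matrix (Unit ⊕ Fin n) (Unit ⊕ Fin n) ℝ :=
  LinearMap.toMatrix
    ((Module.Basis.singleton Unit ℝ).prod (EuclideanSpace.basisFun (Fin n) ℝ).toBasis)
    ((Module.Basis.singleton Unit ℝ).prod (EuclideanSpace.basisFun (Fin n) ℝ).toBasis)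
    (fderiv ℝ F s).toLinearMap

/-- The spectral radius of a real square matrix: the largest modulus of its complex eigenvalues. -/
def realSpectralRadius {ι : Type*} [Fintype ι] [DecidableEq ι] (M : Matrix ι ι ℝ) : ENNReal :=
  spectralRadius ℂ (M.map Complex.ofReal)

/-- The state space `ℝ × S^{n-1}` of the normalized systems. -/
def stateSpace (n : ℕ) : Set (ℝ × EuclideanSpace ℝ (Fin n)) := {s | ‖s.2‖ = 1}

/-- Lyapunov stability of a (nonempty) set `O` under iteration of `F` on the state space `S`. -/
def LyapunovStableOn {X : Type*} [MetricSpace X] (F : X → X) (S O : Set X) : Prop :=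
  ∀ ε > 0, ∃ r > 0, ∀ s ∈ S, Metric.infDist s O < r → ∀ k : ℕ, Metric.infDist (F^[k] s) O < ε

/-- Asymptotic stability: Lyapunov stable, and every trajectory that starts close enough to `O`
converges to `O`. -/
def AsymptoticallyStableOn {X : Type*} [MetricSpace X] (F : X → X) (S O : Set X) : Prop :=
  LyapunovStableOn F S O ∧
    ∃ r > 0, ∀ s ∈ S, Metric.infDist s O < r →
      Filter.Tendsto (fun k : ℕ => Metric.infDist (F^[k] s) O) Filter.atTop (𝓝 0)

/-- The state `(2 / (L + μ), c e₁ + d eₙ)` in dimension `n = m + 2`. -/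
def extremalState (m : ℕ) (L μ c d : ℝ) : ℝ × EuclideanSpace ℝ (Fin (m + 2)) :=
  (2 / (L + μ), EuclideanSpace.single 0 c + EuclideanSpace.single (Fin.last (m + 1)) d)

end

/-! In the eigenbasis the gradient step is diagonal, and everything is homogeneous of degree zero in
`z`, so normalization commutes with a step. For a quadratic, `h_x` is a quadratic polynomial in the
stepsize, whose derivative produces the quotient `⟨z, Λ³z⟩ / ⟨z, Λ²z⟩`. At the extremal states the
two components of `Λz` have equal size. The quotient is then `(L + μ) / 2`, the stepsize `2 / (L +
μ)` is fixed, and the step multiplies the two components by factors of equal modulus and opposite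
sign.

Both systems commute with the reflection `R` of the first coordinate, which exchanges the two orbit
points. The product of the Jacobians is therefore the square of the single operator `U = R ∘ T₂`
(`comp_eq_sq_of_isBlockForm`). `U` kills the radial direction, scales each middle coordinate by a
factor in `(-1, 1)`, and acts by a 2×2 block on the stepsize and the tangential direction. With `u =
η(L + μ)/2 ∈ (0, 1)`, this block has trace `2 - 3u` and determinant `1 - u` for HDM, hence both
roots in the open unit disc. For OSGM-H it has trace `2 - u` and determinant `1 + u`, hence a
conjugate pair of squared modulus `1 + u`.

Stability follows because powers of the linearized second iterate tend to zero
(`asymptoticallyStableOn_of_tendsto_pow`). For instability, no unstable manifold is needed: in the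
invariant plane of the extreme eigenvectors, the coordinates `(α, (z₁/zₙ)²)` collapse the orbit to
one fixed point of `planarOsgm`. Both multipliers there have modulus above one, so every other point
is expelled (`exists_le_dist_iterate_planarOsgm`). -/

/-! ### Coordinates of the diagonal operator and homogeneity of the two systems. -/

theorem diagOp_apply {n : ℕ} (lam : Fin n → ℝ) (z : EuclideanSpace ℝ (Fin n)) (i : Fin n) :
    diagOp lam z i = lam i * z i := by
  simp [diagOp, Matrix.mulVec_diagonal]

theorem diagOp_pow_apply {n : ℕ} (lam : Fin n → ℝ) (k : ℕ) (z : EuclideanSpace ℝ (Fin n))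
    (i : Fin n) : (diagOp lam ^ k) z i = lam i ^ k * z i := by
  induction k with
  | zero => simp
  | succ k ih => rw [pow_succ', mul_apply_eq_comp, diagOp_apply, ih]; ring

theorem inner_diagOp_pow {n : ℕ} (lam : Fin n → ℝ) (k : ℕ) (z x : EuclideanSpace ℝ (Fin n)) :
    inner ℝ z ((diagOp lam ^ k) x) = ∑ i, lam i ^ k * z i * x i := by
  rw [PiLp.inner_apply]
  refine Finset.sum_congr rfl fun i _ => ?_
  rw [diagOp_pow_apply]
  simp
  ring

theorem inner_diagOp_pow_self_pos {n : ℕ} {lam : Fin n → ℝ} (hlam : ∀ i, 0 < lam i) (k : ℕ)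
    {z : EuclideanSpace ℝ (Fin n)} (hz : z ≠ 0) : 0 < inner ℝ z ((diagOp lam ^ k) z) := by
  rw [inner_diagOp_pow]
  obtain ⟨i, hi⟩ : ∃ i, z i ≠ 0 := by
    by_contra! h
    exact hz (by ext i; simpa using h i)
  refine Finset.sum_pos' (fun j _ => ?_) ⟨i, Finset.mem_univ i, ?_⟩
  · rw [mul_assoc]; exact mul_nonneg (pow_pos (hlam j) k).le (mul_self_nonneg _)
  · rw [mul_assoc]; exact mul_pos (pow_pos (hlam i) k) (mul_self_pos.2 hi)

theorem direction_smul {n : ℕ} {r : ℝ} (hr : 0 < r) (z : EuclideanSpace ℝ (Fin n)) :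
    direction (r • z) = direction z := by
  rw [direction, direction, norm_smul, smul_smul, Real.norm_of_nonneg hr.le, mul_inv,
    mul_right_comm, inv_mul_cancel₀ hr.ne', one_mul]

theorem stepsizeUpdate_smul {n : ℕ} (lam : Fin n → ℝ) (η α : ℝ) {r : ℝ} (hr : r ≠ 0)
    (z : EuclideanSpace ℝ (Fin n)) :
    stepsizeUpdate lam η α (r • z) = stepsizeUpdate lam η α z := by
  simp only [stepsizeUpdate, map_smul, inner_smul_left, inner_smul_right, RCLike.conj_to_real,
    ← mul_assoc]
  rw [mul_div_mul_left _ _ (mul_ne_zero hr hr)]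

/-- A positive rescaling of `z` cancels both in the stepsize update and in the direction, so the
iterate need only be normalized after the step. -/
theorem hdmSystem_direction {n : ℕ} (lam : Fin n → ℝ) (η α : ℝ) {z : EuclideanSpace ℝ (Fin n)}
    (hz : z ≠ 0) : hdmSystem lam η (α, direction z) = hdmSystem lam η (α, z) := by
  have h : 0 < ‖z‖⁻¹ := inv_pos.2 (norm_pos_iff.2 hz)
  simp only [hdmSystem]
  rw [direction, stepsizeUpdate_smul lam η α h.ne', map_smul, smul_comm, ← smul_sub,
    direction_smul h]

theorem osgmSystem_direction {n : ℕ} (lam : Fin n → ℝ) (η α : ℝ) {z : EuclideanSpace ℝ (Fin n)}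
    (hz : z ≠ 0) : osgmSystem lam η (α, direction z) = osgmSystem lam η (α, z) := by
  have h : 0 < ‖z‖⁻¹ := inv_pos.2 (norm_pos_iff.2 hz)
  simp only [osgmSystem]
  rw [direction, stepsizeUpdate_smul lam η α h.ne', map_smul, smul_comm, ← smul_sub,
    direction_smul h]

/-! ### The hypergradient of the quadratic and the change of basis by `Q`. -/

theorem inner_toEuclideanCLM_comm {n : ℕ} {A : Matrix (Fin n) (Fin n) ℝ} (hA : A.IsHermitian)
    (x y : EuclideanSpace ℝ (Fin n)) :
    inner ℝ (Matrix.toEuclideanCLM (𝕜 := ℝ) A x) y =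
      inner ℝ x (Matrix.toEuclideanCLM (𝕜 := ℝ) A y) := by
  have h : star (Matrix.toEuclideanCLM (n := Fin n) (𝕜 := ℝ) A) = Matrix.toEuclideanCLM (𝕜 := ℝ) A := by
    rw [← map_star, Matrix.star_eq_conjTranspose, hA.eq]
  rw [← ContinuousLinearMap.adjoint_inner_right, ← ContinuousLinearMap.star_eq_adjoint, h]

theorem gradient_quadObjective {n : ℕ} {A : Matrix (Fin n) (Fin n) ℝ} (hA : A.IsHermitian)
    (x : EuclideanSpace ℝ (Fin n)) :
    gradient (quadObjective A) x = Matrix.toEuclideanCLM (𝕜 := ℝ) A x := by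
  refine HasGradientAt.gradient ?_
  rw [hasGradientAt_iff_hasFDerivAt]
  have h := ((hasFDerivAt_id (𝕜 := ℝ) x).inner ℝ
    (Matrix.toEuclideanCLM (n := Fin n) (𝕜 := ℝ) A).hasFDerivAt).const_mul (1 / 2)
  refine h.congr_fderiv ?_
  ext y
  simp only [smul_apply, ContinuousLinearMap.comp_apply,
    ContinuousLinearMap.prod_apply, fderivInnerCLM_apply, id, ContinuousLinearMap.id_apply,
    InnerProductSpace.toDual_apply_apply, inner_toEuclideanCLM_comm hA, smul_eq_mul]
  rw [← inner_toEuclideanCLM_comm hA x y, real_inner_comm]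
  ring

/-- With `g = Ax`, expanding the quadratic gives `h_x(α) = -α + α² ⟨g, Ag⟩ / (2‖g‖²)`. -/
theorem deriv_hypergradientFeedback_quadObjective {n : ℕ} {A : Matrix (Fin n) (Fin n) ℝ}
    (hA : A.IsHermitian) (x : EuclideanSpace ℝ (Fin n))
    (hx : Matrix.toEuclideanCLM (𝕜 := ℝ) A x ≠ 0) (α : ℝ) :
    deriv (hypergradientFeedback (quadObjective A) x) α =
      -1 + α * (inner ℝ (Matrix.toEuclideanCLM (𝕜 := ℝ) A x)
        (Matrix.toEuclideanCLM (𝕜 := ℝ) A (Matrix.toEuclideanCLM (𝕜 := ℝ) A x)) /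
          ‖Matrix.toEuclideanCLM (𝕜 := ℝ) A x‖ ^ 2) := by
  set g := Matrix.toEuclideanCLM (𝕜 := ℝ) A x with hg
  set w := inner ℝ g (Matrix.toEuclideanCLM (𝕜 := ℝ) A g)
  have hn : ‖g‖ ^ 2 ≠ 0 := pow_ne_zero _ (norm_ne_zero_iff.2 hx)
  have h : hypergradientFeedback (quadObjective A) x =
      fun a => -a + a ^ 2 * (w / (2 * ‖g‖ ^ 2)) := by
    funext a
    rw [hypergradientFeedback, gradient_quadObjective hA, ← hg, quadObjective, quadObjective,
      map_sub, map_smul, ← hg, inner_sub_left, inner_sub_right, inner_sub_right]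
    simp only [inner_smul_left, inner_smul_right, RCLike.conj_to_real]
    rw [← inner_toEuclideanCLM_comm hA x g, ← hg, real_inner_self_eq_norm_sq]
    field_simp
    ring
  rw [h]
  have h2 := ((hasDerivAt_id α).neg).add (((hasDerivAt_id α).pow 2).mul_const (w / (2 * ‖g‖ ^ 2)))
  refine (h2.congr_deriv ?_).deriv
  simp
  field_simp

theorem eigenvalue_pos_of_posDef {n : ℕ} {A Q : Matrix (Fin n) (Fin n) ℝ} {lam : Fin n → ℝ}
    (hA : A.PosDef) (hQ : Q ∈ Matrix.orthogonalGroup (Fin n) ℝ)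
    (hdecomp : A = Q * Matrix.diagonal lam * Qᵀ) (i : Fin n) : 0 < lam i := by
  have h1 : Qᵀ * Q = 1 := (Matrix.mem_orthogonalGroup_iff' (Fin n) ℝ).1 hQ
  have hinj : Function.Injective Q.mulVec := fun v w h => by
    simpa [Matrix.mulVec_mulVec, h1] using congrArg Qᵀ.mulVec h
  have h := hA.conjTranspose_mul_mul_same hinj
  rw [hdecomp, Matrix.conjTranspose_eq_transpose_of_trivial] at h
  have h2 : Qᵀ * (Q * Matrix.diagonal lam * Qᵀ) * Q = Matrix.diagonal lam := by
    simp only [← Matrix.mul_assoc, h1, Matrix.one_mul]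
    rw [Matrix.mul_assoc, h1, Matrix.mul_one]
  rw [h2, Matrix.posDef_diagonal_iff] at h
  exact h i

section Conjugacy

variable {n : ℕ} {A Q : Matrix (Fin n) (Fin n) ℝ} {lam : Fin n → ℝ}

theorem toEuclideanCLM_transpose_apply_apply (hQ : Q ∈ Matrix.orthogonalGroup (Fin n) ℝ)
    (x : EuclideanSpace ℝ (Fin n)) :
    Matrix.toEuclideanCLM (𝕜 := ℝ) Qᵀ (Matrix.toEuclideanCLM (𝕜 := ℝ) Q x) = x := by
  rw [← mul_apply_eq_comp, ← map_mul,
    (Matrix.mem_orthogonalGroup_iff' (Fin n) ℝ).1 hQ, map_one, one_apply_eq_self]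

theorem toEuclideanCLM_apply_transpose_apply (hQ : Q ∈ Matrix.orthogonalGroup (Fin n) ℝ)
    (x : EuclideanSpace ℝ (Fin n)) :
    Matrix.toEuclideanCLM (𝕜 := ℝ) Q (Matrix.toEuclideanCLM (𝕜 := ℝ) Qᵀ x) = x := by
  rw [← mul_apply_eq_comp, ← map_mul,
    (Matrix.mem_orthogonalGroup_iff (Fin n) ℝ).1 hQ, map_one, one_apply_eq_self]

theorem inner_toEuclideanCLM_orthogonal (hQ : Q ∈ Matrix.orthogonalGroup (Fin n) ℝ)
    (x y : EuclideanSpace ℝ (Fin n)) :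
    inner ℝ (Matrix.toEuclideanCLM (𝕜 := ℝ) Q x) (Matrix.toEuclideanCLM (𝕜 := ℝ) Q y) =
      inner ℝ x y := by
  have h : star (Matrix.toEuclideanCLM (n := Fin n) (𝕜 := ℝ) Q) =
      Matrix.toEuclideanCLM (𝕜 := ℝ) Qᵀ := by
    rw [← map_star, Matrix.star_eq_conjTranspose, Matrix.conjTranspose_eq_transpose_of_trivial]
  rw [← ContinuousLinearMap.adjoint_inner_right, ← ContinuousLinearMap.star_eq_adjoint, h,
    toEuclideanCLM_transpose_apply_apply hQ]

theorem toEuclideanCLM_decomp (hQ : Q ∈ Matrix.orthogonalGroup (Fin n) ℝ)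
    (hdecomp : A = Q * Matrix.diagonal lam * Qᵀ) (z : EuclideanSpace ℝ (Fin n)) :
    Matrix.toEuclideanCLM (𝕜 := ℝ) A (Matrix.toEuclideanCLM (𝕜 := ℝ) Q z) =
      Matrix.toEuclideanCLM (𝕜 := ℝ) Q (diagOp lam z) := by
  rw [hdecomp, map_mul, map_mul, mul_apply_eq_comp, mul_apply_eq_comp,
    toEuclideanCLM_transpose_apply_apply hQ, diagOp]

/-- Orthogonality of `Q` turns `‖Ax‖²` into `⟨z, Λ²z⟩` and `⟨Ax, A(Ax)⟩` into `⟨z, Λ³z⟩`. -/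
theorem stepsizeUpdate_eq_hypergradient_step (hA : A.PosDef)
    (hQ : Q ∈ Matrix.orthogonalGroup (Fin n) ℝ)
    (hdecomp : A = Q * Matrix.diagonal lam * Qᵀ) (η α : ℝ) {x z : EuclideanSpace ℝ (Fin n)}
    (hz : z ≠ 0) (hxz : x = Matrix.toEuclideanCLM (𝕜 := ℝ) Q z) :
    α - η * deriv (hypergradientFeedback (quadObjective A) x) α = stepsizeUpdate lam η α z := by
  have hpos := eigenvalue_pos_of_posDef hA hQ hdecomp
  have hAx : Matrix.toEuclideanCLM (𝕜 := ℝ) A x =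
      Matrix.toEuclideanCLM (𝕜 := ℝ) Q (diagOp lam z) := by
    rw [hxz, toEuclideanCLM_decomp hQ hdecomp]
  have hsymm (v w : EuclideanSpace ℝ (Fin n)) :
      inner ℝ (diagOp lam v) w = inner ℝ v (diagOp lam w) :=
    inner_toEuclideanCLM_comm (by simp) v w
  have hnorm : ‖Matrix.toEuclideanCLM (𝕜 := ℝ) A x‖ ^ 2 = inner ℝ z ((diagOp lam ^ 2) z) := by
    rw [← real_inner_self_eq_norm_sq, hAx, inner_toEuclideanCLM_orthogonal hQ, hsymm, pow_two,
      mul_apply_eq_comp]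
  have hne : Matrix.toEuclideanCLM (𝕜 := ℝ) A x ≠ 0 := by
    intro h
    have := inner_diagOp_pow_self_pos hpos 2 hz
    rw [← hnorm, h] at this
    simp at this
  have hcub : inner ℝ (Matrix.toEuclideanCLM (𝕜 := ℝ) A x) (Matrix.toEuclideanCLM (𝕜 := ℝ) A
      (Matrix.toEuclideanCLM (𝕜 := ℝ) A x)) = inner ℝ z ((diagOp lam ^ 3) z) := by
    rw [hAx, toEuclideanCLM_decomp hQ hdecomp, inner_toEuclideanCLM_orthogonal hQ, hsymm, pow_succ',
      pow_two, mul_apply_eq_comp, mul_apply_eq_comp]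
  rw [deriv_hypergradientFeedback_quadObjective hA.1 x hne, hnorm, hcub, stepsizeUpdate]
  ring

theorem normalizedState_step (hA : A.PosDef) (hQ : Q ∈ Matrix.orthogonalGroup (Fin n) ℝ)
    (hdecomp : A = Q * Matrix.diagonal lam * Qᵀ) (η α : ℝ) {x : EuclideanSpace ℝ (Fin n)}
    (hx : x ≠ 0) :
    normalizedState Q (hdmStep (quadObjective A) η (α, x)) =
        hdmSystem lam η (normalizedState Q (α, x)) ∧
      normalizedState Q (osgmStep (quadObjective A) η (α, x)) =
        osgmSystem lam η (normalizedState Q (α, x)) := by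
  set z := Matrix.toEuclideanCLM (𝕜 := ℝ) Qᵀ x with hz
  have hxz : x = Matrix.toEuclideanCLM (𝕜 := ℝ) Q z :=
    (toEuclideanCLM_apply_transpose_apply hQ x).symm
  have hz0 : z ≠ 0 := by
    intro h
    rw [h, map_zero] at hxz
    exact hx hxz
  have hstep := stepsizeUpdate_eq_hypergradient_step hA hQ hdecomp η α hz0 hxz
  have hgrad (β : ℝ) : Matrix.toEuclideanCLM (𝕜 := ℝ) Qᵀ
      (x - β • gradient (quadObjective A) x) = z - β • diagOp lam z := by
    rw [gradient_quadObjective hA.1, map_sub, map_smul, ← hz]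
    conv_lhs => rw [hxz]
    rw [toEuclideanCLM_decomp hQ hdecomp, toEuclideanCLM_transpose_apply_apply hQ]
  constructor
  · simp only [normalizedState, hdmStep]
    rw [← hz, hdmSystem_direction lam η α hz0, hgrad, hstep]
    rfl
  · simp only [normalizedState, osgmStep]
    rw [← hz, osgmSystem_direction lam η α hz0, hgrad, hstep]
    rfl

end Conjugacy


/-! ### Complex spectra of real matrices and convergence of powers. -/

/-- Left eigenvectors of the matrix are complex-valued functionals on the real space, so eigenvalues
can be studied without bases and without complexifying the space. -/
theorem mem_spectrum_map_toMatrix_iff {ι E : Type*} [Fintype ι] [DecidableEq ι] [AddCommGroup E]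
    [Module ℝ E] (b : Module.Basis ι ℝ E) (U : E →ₗ[ℝ] E) (z : ℂ) :
    z ∈ spectrum ℂ ((LinearMap.toMatrix b b U).map Complex.ofReal) ↔
      ∃ ψ : E →ₗ[ℝ] ℂ, ψ ≠ 0 ∧ ∀ x, ψ (U x) = z * ψ x := by
  set M := (LinearMap.toMatrix b b U).map Complex.ofReal with hM
  have key (ψ : E →ₗ[ℝ] ℂ) (j : ι) : ψ (U (b j)) = ((fun i => ψ (b i)) ᵥ* M) j := by
    rw [← b.sum_repr (U (b j)), map_sum]
    simp only [map_smul, Matrix.vecMul, dotProduct, hM, Matrix.map_apply,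
      LinearMap.toMatrix_apply, Complex.real_smul]
    exact Finset.sum_congr rfl fun i _ => mul_comm _ _
  rw [spectrum.mem_iff, Matrix.isUnit_iff_isUnit_det, isUnit_iff_ne_zero, not_not,
    ← Matrix.exists_vecMul_eq_zero_iff]
  constructor
  · rintro ⟨w, hw, h⟩
    refine ⟨b.constr ℝ w, fun h0 => hw ?_, ?_⟩
    · funext i
      simpa using congrArg (fun f : E →ₗ[ℝ] ℂ => f (b i)) h0
    · have hlin : (b.constr ℝ w) ∘ₗ U = z • (b.constr ℝ w) := by
        refine b.ext fun j => ?_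
        rw [LinearMap.comp_apply, key]
        have hj := congrFun h j
        rw [Matrix.vecMul_sub, Matrix.algebraMap_eq_diagonal] at hj
        simp only [Pi.sub_apply, Pi.zero_apply, Matrix.vecMul_diagonal, sub_eq_zero] at hj
        simp only [Module.Basis.constr_basis, LinearMap.smul_apply, smul_eq_mul]
        rw [← hj]
        simp [mul_comm]
      intro x
      simpa using congrArg (fun f : E →ₗ[ℝ] ℂ => f x) hlin
  · rintro ⟨ψ, hψ, h⟩
    refine ⟨fun i => ψ (b i), fun h0 => hψ (b.ext fun i => congrFun h0 i), ?_⟩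
    funext j
    rw [Matrix.vecMul_sub, Pi.sub_apply, ← key, h, Matrix.algebraMap_eq_diagonal,
      Matrix.vecMul_diagonal]
    simp [mul_comm]

attribute [local instance] Matrix.linftyOpNormedRing Matrix.linftyOpNormedAlgebra in
theorem realSpectralRadius_lt_one_of_forall {ι : Type*} [Fintype ι] [DecidableEq ι]
    [Nonempty ι] {M : Matrix ι ι ℝ}
    (h : ∀ z ∈ spectrum ℂ (M.map Complex.ofReal), ‖z‖ < 1) : realSpectralRadius M < 1 := by
  have := spectrum.spectralRadius_lt_of_forall_lt (M.map Complex.ofReal) (r := 1)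
    fun z hz => by exact_mod_cast h z hz
  exact_mod_cast this

theorem realSpectralRadius_eq_of_forall_le {ι : Type*} [Fintype ι] [DecidableEq ι]
    {M : Matrix ι ι ℝ} {r : ℝ} (h : ∀ z ∈ spectrum ℂ (M.map Complex.ofReal), ‖z‖ ≤ r)
    (hr : ∃ z ∈ spectrum ℂ (M.map Complex.ofReal), ‖z‖ = r) :
    realSpectralRadius M = ENNReal.ofReal r := by
  refine le_antisymm (iSup₂_le fun z hz => ?_) ?_
  · rw [← enorm_eq_nnnorm, ← ofReal_norm]
    exact ENNReal.ofReal_le_ofReal (h z hz)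
  · obtain ⟨z, hz, rfl⟩ := hr
    rw [ofReal_norm, enorm_eq_nnnorm]
    exact le_iSup₂ (f := fun (k : ℂ) (_ : k ∈ spectrum ℂ (M.map Complex.ofReal)) =>
      ((‖k‖₊ : NNReal) : ENNReal)) z hz

theorem mem_spectrum_map_ofReal_mul_self_iff {ι : Type*} [Fintype ι] [DecidableEq ι]
    (M : Matrix ι ι ℝ) (z : ℂ) :
    z ∈ spectrum ℂ ((M * M).map Complex.ofReal) ↔
      ∃ w ∈ spectrum ℂ (M.map Complex.ofReal), w ^ 2 = z := by
  have h : (M * M).map Complex.ofReal = (M.map Complex.ofReal) ^ 2 := by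
    rw [pow_two]
    exact Matrix.map_mul (f := Complex.ofRealHom)
  rw [h, spectrum.map_pow_of_pos _ two_pos]
  rfl

-- Gelfand's formula, which needs a submultiplicative norm on the matrices, makes `‖C ^ k‖` decay
-- geometrically; the result returns to real matrices through the real part.
attribute [local instance] Matrix.linftyOpNormedRing Matrix.linftyOpNormedAlgebra in
theorem tendsto_pow_of_realSpectralRadius_lt_one {ι : Type*} [Fintype ι] [DecidableEq ι]
    {M : Matrix ι ι ℝ} (h : realSpectralRadius M < 1) :
    Filter.Tendsto (fun k : ℕ => M ^ k) Filter.atTop (𝓝 0) := by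
  set C := M.map Complex.ofReal with hC
  have hgel := spectrum.pow_norm_pow_one_div_tendsto_nhds_spectralRadius C
  obtain ⟨r, hr, hr1⟩ := exists_between h
  have hlim : Filter.Tendsto (fun k : ℕ => C ^ k) Filter.atTop (𝓝 0) := by
    have hr1' : r.toReal < 1 := by
      simpa using ENNReal.toReal_strict_mono ENNReal.one_ne_top hr1
    -- For `r` strictly between the spectral radius and one, eventually `‖C ^ k‖ ≤ r ^ k`. The
    -- exponent `k = 0` is excluded in order to take `k`-th roots.
    refine squeeze_zero_norm' ?_
      (tendsto_pow_atTop_nhds_zero_of_lt_one ENNReal.toReal_nonneg hr1')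
    filter_upwards [hgel.eventually_lt_const hr, Filter.eventually_gt_atTop 0] with k hk hk0
    have h1 : ‖C ^ k‖ ^ (1 / (k : ℝ)) ≤ r.toReal :=
      ((ENNReal.ofReal_lt_iff_lt_toReal (by positivity) hr1.ne_top).1 hk).le
    calc ‖C ^ k‖ = (‖C ^ k‖ ^ (1 / (k : ℝ))) ^ k := by
          rw [one_div, Real.rpow_inv_natCast_pow (norm_nonneg _) hk0.ne']
      _ ≤ r.toReal ^ k := pow_le_pow_left₀ (by positivity) h1 k
  have hmap (k : ℕ) : (C ^ k).map Complex.re = M ^ k := by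
    have : C ^ k = (M ^ k).map Complex.ofReal := by
      rw [hC]
      exact (map_pow (Complex.ofRealHom.mapMatrix) M k).symm
    rw [this]
    ext i j
    simp
  have hcont : Continuous fun X : Matrix ι ι ℂ => X.map Complex.re :=
    continuous_id.matrix_map Complex.continuous_re
  have := (hcont.tendsto 0).comp hlim
  simpa [Function.comp_def, hmap] using this

theorem tendsto_pow_of_realSpectralRadius_toMatrix_lt_one {ι E : Type*} [Fintype ι] [DecidableEq ι]
    [NormedAddCommGroup E] [NormedSpace ℝ E] (b : Module.Basis ι ℝ E) (T : E →L[ℝ] E)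
    (h : realSpectralRadius (LinearMap.toMatrix b b T.toLinearMap) < 1) :
    Filter.Tendsto (fun k : ℕ => T ^ k) Filter.atTop (𝓝 0) := by
  have : FiniteDimensional ℝ E := b.finiteDimensional_of_finite
  let e : Matrix ι ι ℝ →ₗ[ℝ] (E →L[ℝ] E) :=
    LinearMap.toContinuousLinearMap.toLinearMap ∘ₗ (Matrix.toLin b b).toLinearMap
  have he : Continuous e := e.continuous_of_finiteDimensional
  have h2 := (he.tendsto 0).comp (tendsto_pow_of_realSpectralRadius_lt_one h)
  have hpow (k : ℕ) : e (LinearMap.toMatrix b b T.toLinearMap ^ k) = T ^ k := by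
    have hM : LinearMap.toMatrix b b T.toLinearMap ^ k =
        LinearMap.toMatrix b b (T ^ k).toLinearMap := by
      rw [ContinuousLinearMap.toLinearMap_pow]
      exact (map_pow (LinearMap.toMatrixAlgEquiv b) T.toLinearMap k).symm
    ext x
    simp only [e, LinearMap.comp_apply, LinearEquiv.coe_coe, hM, Matrix.toLin_toMatrix]
    rfl
  simpa [Function.comp_def, hpow] using h2


/-! ### Local dynamics: attraction and expulsion read off the derivative. -/

section Dynamics

/-- Some power `T ^ N` has norm below `1/4`, and near `p` the nonlinear error of `G^[N]` costs
another `1/4`; hence a contraction by `1/2`. -/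
theorem exists_iterate_dist_le_of_tendsto_pow {E : Type*} [NormedAddCommGroup E] [NormedSpace ℝ E]
    {G : E → E} {T : E →L[ℝ] E} {p : E} (hG : HasFDerivAt G T p) (hp : G p = p)
    (hT : Filter.Tendsto (fun k : ℕ => T ^ k) Filter.atTop (𝓝 0)) :
    ∃ N > 0, ∃ r > 0, ∀ x, dist x p < r → ∀ q : ℕ,
      dist ((G^[N])^[q] x) p ≤ (1 / 2) ^ q * dist x p := by
  obtain ⟨N, hN, hN0⟩ := ((hT.norm.eventually_lt_const (u := 1 / 4) (by simp)).and
    (Filter.eventually_gt_atTop 0)).exists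
  have hiter := hG.iterate hp N
  have hpN : G^[N] p = p := Function.iterate_fixed hp N
  obtain ⟨r, hr, hball⟩ := Metric.eventually_nhds_iff.1
    (hiter.isLittleO.def (c := 1 / 4) (by norm_num))
  have hstep (x : E) (hx : dist x p < r) : dist (G^[N] x) p ≤ 1 / 2 * dist x p := by
    have h1 := hball hx
    rw [hpN] at h1
    have h2 : ‖(T ^ N) (x - p)‖ ≤ 1 / 4 * ‖x - p‖ :=
      ((T ^ N).le_opNorm _).trans (by gcongr)
    have h3 := norm_add_le (G^[N] x - p - (T ^ N) (x - p)) ((T ^ N) (x - p))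
    rw [sub_add_cancel] at h3
    rw [dist_eq_norm, dist_eq_norm]
    linarith
  refine ⟨N, hN0, r, hr, fun x hx q => ?_⟩
  induction q with
  | zero => simp
  | succ q ih =>
    have h1 : dist ((G^[N])^[q] x) p < r :=
      (ih.trans (mul_le_of_le_one_left dist_nonneg
        (pow_le_one₀ (by norm_num) (by norm_num)))).trans_lt hx
    rw [Function.iterate_succ_apply']
    calc _ ≤ 1 / 2 * dist ((G^[N])^[q] x) p := hstep _ h1
      _ ≤ 1 / 2 * ((1 / 2) ^ q * dist x p) := by gcongr
      _ = _ := by ring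

/-- The second iterate fixes `q` with derivative `Tp ∘ Tq`, so some `(F^[2])^[N]` contracts near
`q`. The finitely many intermediate times are handled by continuity, and points near `p` are moved
near `q` by one step. -/
theorem asymptoticallyStableOn_of_tendsto_pow {E : Type*} [NormedAddCommGroup E] [NormedSpace ℝ E]
    {F : E → E} {p q : E} {Tp Tq : E →L[ℝ] E} (hp : HasFDerivAt F Tp p) (hq : HasFDerivAt F Tq q)
    (hpq : F p = q) (hqp : F q = p)
    (hT : Filter.Tendsto (fun k : ℕ => (Tp ∘L Tq) ^ k) Filter.atTop (𝓝 0)) (S : Set E) :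
    AsymptoticallyStableOn F S {p, q} := by
  have hne : ({p, q} : Set E).Nonempty := ⟨p, by simp⟩
  have hG : HasFDerivAt F^[2] (Tp ∘L Tq) q := by
    have hp' : HasFDerivAt F Tp (F q) := by rwa [hqp]
    exact hp'.comp q hq
  have hGq : F^[2] q = q := by simp [hqp, hpq]
  obtain ⟨N, hN, r, hr, hcontr⟩ := exists_iterate_dist_le_of_tendsto_pow hG hGq hT
  have hiter (j : ℕ) : F^[j] q ∈ ({p, q} : Set E) ∧ ContinuousAt F^[j] q := by
    induction j with
    | zero => exact ⟨by simp, continuousAt_id⟩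
    | succ j ih =>
      obtain ⟨h1, h2⟩ := ih
      rw [Function.iterate_succ', Function.comp_apply]
      rcases h1 with h1 | h1
      · exact ⟨by simp [h1, hpq], ContinuousAt.comp (by rw [h1]; exact hp.continuousAt) h2⟩
      · rw [Set.mem_singleton_iff] at h1
        exact ⟨by simp [h1, hqp], ContinuousAt.comp (by rw [h1]; exact hq.continuousAt) h2⟩
  have hnear (ε : ℝ) (hε : 0 < ε) : ∃ δ > 0, ∀ y, dist y q < δ → ∀ j < 2 * N,
      Metric.infDist (F^[j] y) {p, q} < ε := by
    have : ∀ᶠ y in 𝓝 q, ∀ j < 2 * N, Metric.infDist (F^[j] y) {p, q} < ε := by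
      refine (Set.finite_lt_nat (2 * N)).eventually_all.2 fun j _ => ?_
      filter_upwards [Metric.tendsto_nhds.1 (hiter j).2 ε hε] with y hy
      exact (Metric.infDist_le_dist_of_mem (hiter j).1).trans_lt hy
    exact Metric.eventually_nhds_iff.1 this
  -- Full periods of length `2 * N` contract towards `q`; the remainder is one of the finitely many
  -- iterates covered by `hnear`.
  have hsplit (k : ℕ) (x : E) : F^[k] x = F^[k % (2 * N)] (((F^[2])^[N])^[k / (2 * N)] x) := by
    rw [← Function.iterate_mul, ← Function.iterate_mul, ← Function.iterate_add_apply,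
      ← mul_assoc, Nat.mod_add_div]
  have hmod (k : ℕ) : k % (2 * N) < 2 * N := Nat.mod_lt _ (by omega)
  have hstabq (ε : ℝ) (hε : 0 < ε) : ∃ δ > 0, ∀ x, dist x q < δ → ∀ k : ℕ,
      Metric.infDist (F^[k] x) {p, q} < ε := by
    obtain ⟨δ, hδ, h⟩ := hnear ε hε
    refine ⟨min r δ, lt_min hr hδ, fun x hx k => ?_⟩
    rw [hsplit]
    refine h _ (lt_of_le_of_lt ?_ (hx.trans_le (min_le_right _ _))) _ (hmod k)
    exact (hcontr x (hx.trans_le (min_le_left _ _)) _).trans (mul_le_of_le_one_left dist_nonneg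
        (pow_le_one₀ (by norm_num) (by norm_num)))
  have hlimq (x : E) (hx : dist x q < r) :
      Filter.Tendsto (fun k : ℕ => Metric.infDist (F^[k] x) {p, q}) Filter.atTop (𝓝 0) := by
    rw [Metric.tendsto_atTop]
    intro ε hε
    obtain ⟨δ, hδ, h⟩ := hnear ε hε
    have hpow : Filter.Tendsto (fun k : ℕ => (1 / 2 : ℝ) ^ k * dist x q) Filter.atTop (𝓝 0) := by
      simpa using (tendsto_pow_atTop_nhds_zero_of_lt_one (r := (1 / 2 : ℝ)) (by norm_num)
        (by norm_num)).mul_const (dist x q)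
    obtain ⟨K, hK⟩ := Filter.eventually_atTop.1 (hpow.eventually_lt_const hδ)
    refine ⟨2 * N * K, fun k hk => ?_⟩
    rw [Real.dist_eq, sub_zero, abs_of_nonneg Metric.infDist_nonneg, hsplit]
    refine h _ ((hcontr x hx _).trans_lt (hK _ ?_)) _ (hmod k)
    exact (Nat.le_div_iff_mul_le (by omega)).2 (by linarith)
  have hFp (ε : ℝ) (hε : 0 < ε) : ∃ δ > 0, ∀ x, dist x p < δ → dist (F x) q < ε := by
    have := Metric.tendsto_nhds.1 hp.continuousAt ε hε
    rw [hpq] at this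
    exact Metric.eventually_nhds_iff.1 this
  refine ⟨fun ε hε => ?_, ?_⟩
  · obtain ⟨δ, hδ, h⟩ := hstabq ε hε
    obtain ⟨δ', hδ', h'⟩ := hFp δ hδ
    refine ⟨min ε (min δ δ'), by positivity, fun x _ hx k => ?_⟩
    rcases (Metric.infDist_lt_iff hne).1 hx with ⟨y, hy | hy, hxy⟩
    · rw [hy, lt_min_iff, lt_min_iff] at hxy
      -- Near `p` the estimate applies to the trajectory of `F x`, which omits time zero; the cap
      -- `ε` on the radius covers that time.
      cases k with
      | zero => exact hx.trans_le (min_le_left _ _)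
      | succ k => exact h _ (h' x hxy.2.2) k
    · rw [Set.mem_singleton_iff] at hy
      rw [hy, lt_min_iff, lt_min_iff] at hxy
      exact h x hxy.2.1 k
  · obtain ⟨δ', hδ', h'⟩ := hFp r hr
    refine ⟨min r δ', by positivity, fun x _ hx => ?_⟩
    rcases (Metric.infDist_lt_iff hne).1 hx with ⟨y, hy | hy, hxy⟩
    · rw [hy, lt_min_iff] at hxy
      exact (Filter.tendsto_add_atTop_iff_nat 1).1 (hlimq (F x) (h' x hxy.2))
    · rw [Set.mem_singleton_iff] at hy
      rw [hy, lt_min_iff] at hxy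
      exact hlimq x hxy.1

/-- Measured through `ψ`, the linear part expands every vector by `ρ`. The nonlinear error uses up
at most half of `ρ - 1`, so a trajectory confined to the ball would grow like `((ρ + 1) / 2) ^ k`,
which is absurd. -/
theorem exists_le_dist_iterate_of_expanding {E V : Type*} [NormedAddCommGroup E] [NormedSpace ℝ E]
    [NormedAddCommGroup V] [NormedSpace ℝ V] {H : E → E} {T : E →L[ℝ] E} {p : E}
    (hH : HasFDerivAt H T p) (hp : H p = p) (ψ : E →L[ℝ] V) {C ρ : ℝ} (hC : 0 ≤ C)
    (hψ : ∀ v, ‖v‖ ≤ C * ‖ψ v‖) (hρ : 1 < ρ) (hT : ∀ v, ρ * ‖ψ v‖ ≤ ‖ψ (T v)‖) :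
    ∃ ε > 0, ∀ x, x ≠ p → ∃ k : ℕ, ε ≤ dist (H^[k] x) p := by
  -- Chosen so that `‖ψ‖ * C * c ≤ (ρ - 1) / 2`; the `+ 1` keeps the denominator positive.
  set c := (ρ - 1) / 2 / (‖ψ‖ * C + 1) with hc
  have hden : 0 < ‖ψ‖ * C + 1 := by positivity
  have hc0 : 0 < c := div_pos (by linarith) hden
  obtain ⟨ε, hε, hball⟩ := Metric.eventually_nhds_iff.1 (hH.isLittleO.def hc0)
  have hstep (x : E) (hx : dist x p < ε) : (ρ + 1) / 2 * ‖ψ (x - p)‖ ≤ ‖ψ (H x - p)‖ := by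
    have h1 := hball hx
    rw [hp] at h1
    have h2 : ‖ψ (H x - p - T (x - p))‖ ≤ (ρ - 1) / 2 * ‖ψ (x - p)‖ :=
      calc _ ≤ ‖ψ‖ * ‖H x - p - T (x - p)‖ := ψ.le_opNorm _
        _ ≤ ‖ψ‖ * (c * (C * ‖ψ (x - p)‖)) := by
          gcongr
          exact h1.trans (by gcongr; exact hψ _)
        _ = (‖ψ‖ * C) * c * ‖ψ (x - p)‖ := by ring
        _ ≤ (‖ψ‖ * C + 1) * c * ‖ψ (x - p)‖ := by gcongr; linarith
        _ = (ρ - 1) / 2 * ‖ψ (x - p)‖ := by rw [hc, mul_div_cancel₀ _ hden.ne']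
    have h3 := norm_sub_norm_le (ψ (T (x - p))) (-ψ (H x - p - T (x - p)))
    rw [sub_neg_eq_add, ← map_add, add_sub_cancel, norm_neg] at h3
    have h4 := hT (x - p)
    linarith
  refine ⟨ε, hε, fun x hx => ?_⟩
  by_contra! hbd
  have hx0 : 0 < ‖ψ (x - p)‖ := by
    have h1 : 0 < ‖x - p‖ := norm_pos_iff.2 (sub_ne_zero.2 hx)
    by_contra! h2
    have := hψ (x - p)
    nlinarith
  have hgrow (k : ℕ) : ((ρ + 1) / 2) ^ k * ‖ψ (x - p)‖ ≤ ‖ψ (H^[k] x - p)‖ := by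
    induction k with
    | zero => simp
    | succ k ih =>
      rw [Function.iterate_succ_apply']
      refine le_trans ?_ (hstep _ (hbd k))
      rw [pow_succ', mul_assoc]
      gcongr
  obtain ⟨k, hk⟩ := pow_unbounded_of_one_lt (‖ψ‖ * ε / ‖ψ (x - p)‖)
    (show 1 < (ρ + 1) / 2 by linarith)
  rw [div_lt_iff₀ hx0] at hk
  have h1 : ‖ψ (H^[k] x - p)‖ ≤ ‖ψ‖ * ε := (ψ.le_opNorm _).trans (by
    gcongr
    rw [← dist_eq_norm]
    exact (hbd k).le)
  linarith [hgrow k]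

end Dynamics


/-! ### Moduli of the roots of a real monic quadratic. -/

section Quadratic

theorem exists_root_of_discrim_neg {t e : ℝ} (h : t ^ 2 < 4 * e) :
    ∃ z : ℂ, z ^ 2 - t * z + e = 0 ∧ z.im ≠ 0 := by
  have hpos : 0 < 4 * e - t ^ 2 := by linarith
  refine ⟨⟨t / 2, √(4 * e - t ^ 2) / 2⟩, ?_, by
    simpa using (Real.sqrt_pos.2 hpos).ne'⟩
  have hs := Real.sq_sqrt hpos.le
  simp only [pow_two] at hs
  apply Complex.ext
  · simp [pow_two]
    linarith
  · simp [pow_two]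
    ring

/-- The other root is the conjugate, and `e` is the product of the roots. -/
theorem normSq_of_root_of_im_ne_zero {t e : ℝ} {z : ℂ} (hz : z ^ 2 - t * z + e = 0)
    (hi : z.im ≠ 0) : ‖z‖ ^ 2 = e := by
  have hre := congrArg Complex.re hz
  have him := congrArg Complex.im hz
  simp [pow_two] at hre him
  rw [← Complex.normSq_eq_norm_sq, Complex.normSq_apply]
  have h2 : 2 * z.re = t := by
    apply mul_right_cancel₀ hi
    linarith
  subst h2
  linarith

theorem im_ne_zero_of_root {t e : ℝ} (h : t ^ 2 < 4 * e) {z : ℂ}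
    (hz : z ^ 2 - t * z + e = 0) : z.im ≠ 0 := by
  intro hi
  have hre := congrArg Complex.re hz
  simp [pow_two, hi] at hre
  nlinarith [sq_nonneg (2 * z.re - t)]

/-- The Schur–Jury criterion: for a real root the polynomial is positive at `±1` while the product
of the roots is below one; a nonreal root has squared modulus `e`. -/
theorem norm_lt_one_of_root {t e : ℝ} (h1 : t < 1 + e) (h2 : -(1 + e) < t) (he : e < 1)
    {z : ℂ} (hz : z ^ 2 - t * z + e = 0) : ‖z‖ < 1 := by
  by_cases hi : z.im = 0
  · have hre := congrArg Complex.re hz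
    simp [pow_two, hi] at hre
    have hnorm : ‖z‖ = |z.re| := (Complex.abs_re_eq_norm.2 hi).symm
    rw [hnorm, abs_lt]
    constructor <;> by_contra! hc <;> nlinarith
  · have := normSq_of_root_of_im_ne_zero hz hi
    nlinarith [norm_nonneg z]

end Quadratic

/-! ### Eigenvalues of operators in block form. -/

section BlockForm

variable {m : ℕ}

/-- `U` maps the radial direction `(c, d)` of the plane spanned by the first and the last coordinate
to zero, acts on the plane spanned by the stepsize and the tangential direction `(d, -c)` by the
matrix with entries `b₁₁, b₁₂, b₂₁, b₂₂`, and scales the other coordinates. -/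
structure IsBlockForm (c d b₁₁ b₁₂ b₂₁ b₂₂ : ℝ) (D : Fin (m + 2) → ℝ)
    (U : ℝ × EuclideanSpace ℝ (Fin (m + 2)) → ℝ × EuclideanSpace ℝ (Fin (m + 2))) : Prop where
  fst : ∀ v, (U v).1 = b₁₁ * v.1 + b₁₂ * (d * v.2 0 - c * v.2 (Fin.last (m + 1)))
  zero : ∀ v, (U v).2 0 = d * (b₂₁ * v.1 + b₂₂ * (d * v.2 0 - c * v.2 (Fin.last (m + 1))))
  last : ∀ v, (U v).2 (Fin.last (m + 1)) =
    -c * (b₂₁ * v.1 + b₂₂ * (d * v.2 0 - c * v.2 (Fin.last (m + 1))))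
  middle : ∀ v i, i ≠ 0 → i ≠ Fin.last (m + 1) → (U v).2 i = D i * v.2 i

theorem stateProd_ext {u v : ℝ × EuclideanSpace ℝ (Fin (m + 2))} (h1 : u.1 = v.1)
    (h0 : u.2 0 = v.2 0) (hn : u.2 (Fin.last (m + 1)) = v.2 (Fin.last (m + 1)))
    (hi : ∀ i, i ≠ 0 → i ≠ Fin.last (m + 1) → u.2 i = v.2 i) : u = v := by
  refine Prod.ext h1 (PiLp.ext fun i => ?_)
  by_cases hi0 : i = 0
  · rw [hi0, h0]
  · by_cases hin : i = Fin.last (m + 1)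
    · rw [hin, hn]
    · exact hi i hi0 hin

variable {c d b₁₁ b₁₂ b₂₁ b₂₂ : ℝ} {D : Fin (m + 2) → ℝ}
  {U : ℝ × EuclideanSpace ℝ (Fin (m + 2)) →ₗ[ℝ] ℝ × EuclideanSpace ℝ (Fin (m + 2))}

/-- If `z` avoided every listed value, `ψ` would vanish on the middle basis vectors, on the radial
vector, and on the stepsize and tangential vectors, which together span. -/
theorem IsBlockForm.eigenvalue_cases (hcd : c ^ 2 + d ^ 2 = 1)
    (hU : IsBlockForm c d b₁₁ b₁₂ b₂₁ b₂₂ D U) {z : ℂ}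
    {ψ : ℝ × EuclideanSpace ℝ (Fin (m + 2)) →ₗ[ℝ] ℂ} (hψ : ψ ≠ 0)
    (h : ∀ x, ψ (U x) = z * ψ x) :
    z = 0 ∨ (∃ i, i ≠ 0 ∧ i ≠ Fin.last (m + 1) ∧ z = D i) ∨
      z ^ 2 - ((b₁₁ + b₂₂ : ℝ) : ℂ) * z + ((b₁₁ * b₂₂ - b₁₂ * b₂₁ : ℝ) : ℂ) = 0 := by
  by_contra! hcon
  obtain ⟨hz0, hzD, hzq⟩ := hcon
  have hl : Fin.last (m + 1) ≠ 0 := (Fin.last_pos).ne'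
  have hl' : (0 : Fin (m + 2)) ≠ Fin.last (m + 1) := hl.symm
  let e0 : EuclideanSpace ℝ (Fin (m + 2)) := EuclideanSpace.single 0 1
  let en : EuclideanSpace ℝ (Fin (m + 2)) := EuclideanSpace.single (Fin.last (m + 1)) 1
  have hmid (i : Fin (m + 2)) (hi0 : i ≠ 0) (hin : i ≠ Fin.last (m + 1)) :
      ψ (0, EuclideanSpace.single i 1) = 0 := by
    have hUi : U (0, EuclideanSpace.single i 1) = D i • (0, EuclideanSpace.single i 1) := by
      apply stateProd_ext
      · simp [hU.fst, hi0.symm, hin.symm]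
      · simp [hU.zero, hi0.symm, hin.symm]
      · simp [hU.last, hi0.symm, hin.symm]
      · intro j hj0 hjn
        rw [hU.middle _ j hj0 hjn]
        by_cases hij : j = i
        · simp [hij]
        · simp [hij]
    have h1 := h (0, EuclideanSpace.single i 1)
    rw [hUi, map_smul, Complex.real_smul] at h1
    have h2 := sub_ne_zero.2 (hzD i hi0 hin)
    have h3 : (z - D i) * ψ (0, EuclideanSpace.single i 1) = 0 := by
      rw [sub_mul, h1, sub_self]
    exact (mul_eq_zero.1 h3).resolve_left h2
  have hrad : ψ (0, c • e0 + d • en) = 0 := by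
    have hUr : U (0, c • e0 + d • en) = 0 := by
      apply stateProd_ext
      · simp [hU.fst, e0, en, hl, hl']; right; ring
      · simp [hU.zero, e0, en, hl, hl']; right; right; ring
      · simp [hU.last, e0, en, hl, hl']; right; right; ring
      · intro j hj0 hjn
        rw [hU.middle _ j hj0 hjn]
        simp [e0, en, hj0, hjn]
    have h1 := h (0, c • e0 + d • en)
    rw [hUr, map_zero] at h1
    exact (mul_eq_zero.1 h1.symm).resolve_left hz0
  have hUa : U (1, 0) = b₁₁ • (1, 0) + b₂₁ • (0, d • e0 - c • en) := by
    apply stateProd_ext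
    · simp [hU.fst]
    · simp [hU.zero, e0, en, hl']; ring
    · simp [hU.last, e0, en, hl]; ring
    · intro j hj0 hjn
      rw [hU.middle _ j hj0 hjn]
      simp [e0, en, hj0, hjn]
  have hUt : U (0, d • e0 - c • en) = b₁₂ • (1, 0) + b₂₂ • (0, d • e0 - c • en) := by
    have ht : d * d + c * c = 1 := by linarith
    apply stateProd_ext
    · simp [hU.fst, e0, en, hl, hl', ht]
    · simp [hU.zero, e0, en, hl, hl', ht]; ring
    · simp [hU.last, e0, en, hl, hl', ht]; ring
    · intro j hj0 hjn
      rw [hU.middle _ j hj0 hjn]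
      simp [e0, en, hj0, hjn]
  have h1 := h (1, 0)
  have h2 := h (0, d • e0 - c • en)
  rw [hUa] at h1
  rw [hUt] at h2
  simp only [map_add, map_smul, Complex.real_smul] at h1 h2
  set x := ψ (1, 0)
  set y := ψ (0, d • e0 - c • en) with hy
  push_cast at hzq
  -- `h1` and `h2` form a homogeneous 2×2 system in `x`, `y` whose determinant is the characteristic
  -- polynomial of the block; the coefficients below are adjugate entries.
  have hx0 : x = 0 := by
    refine (mul_eq_zero.1 (?_ : (z ^ 2 - (b₁₁ + b₂₂) * z + (b₁₁ * b₂₂ - b₁₂ * b₂₁)) * x = 0)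
      ).resolve_left hzq
    linear_combination (b₂₂ - z) * h1 - b₂₁ * h2
  have hy0 : y = 0 := by
    refine (mul_eq_zero.1 (?_ : (z ^ 2 - (b₁₁ + b₂₂) * z + (b₁₁ * b₂₂ - b₁₂ * b₂₁)) * y = 0)
      ).resolve_left hzq
    linear_combination (b₁₁ - z) * h2 - b₁₂ * h1
  refine hψ (LinearMap.ext fun v => ?_)
  have hE0 : ψ (0, e0) = 0 := by
    have : ((0 : ℝ), e0) = d • (0, d • e0 - c • en) + c • (0, c • e0 + d • en) := by
      apply stateProd_ext
      · simp
      · simp [e0, en, hl']; linarith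
      · simp [e0, en, hl]; ring
      · intro j hj0 hjn
        simp [e0, en, hj0, hjn]
    rw [this, map_add, map_smul, map_smul, hrad, ← hy, hy0]
    simp
  have hEn : ψ (0, en) = 0 := by
    have : ((0 : ℝ), en) = (-c) • (0, d • e0 - c • en) + d • (0, c • e0 + d • en) := by
      apply stateProd_ext
      · simp
      · simp [e0, en, hl']; ring
      · simp [e0, en, hl]; linarith
      · intro j hj0 hjn
        simp [e0, en, hj0, hjn]
    rw [this, map_add, map_smul, map_smul, hrad, ← hy, hy0]
    simp
  have hall (i : Fin (m + 2)) : ψ (0, EuclideanSpace.single i 1) = 0 := by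
    by_cases hi0 : i = 0
    · rw [hi0]; exact hE0
    · by_cases hin : i = Fin.last (m + 1)
      · rw [hin]; exact hEn
      · exact hmid i hi0 hin
  have hv : v = v.1 • (1, 0) + LinearMap.inr ℝ ℝ (EuclideanSpace ℝ (Fin (m + 2))) v.2 := by
    ext <;> simp
  have hzero : ψ ∘ₗ LinearMap.inr ℝ ℝ (EuclideanSpace ℝ (Fin (m + 2))) = 0 := by
    refine (EuclideanSpace.basisFun (Fin (m + 2)) ℝ).toBasis.ext fun i => ?_
    simpa using hall i
  have hzero' := congrArg (fun f => f v.2) hzero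
  simp only [LinearMap.comp_apply, LinearMap.zero_apply] at hzero'
  rw [hv, map_add, map_smul, hzero']
  change v.1 • x + 0 = 0
  rw [hx0, smul_zero, add_zero]

/-- `(b₂₁, z - b₁₁)` is a left eigenvector of the block, extended by zero to the radial and middle
directions; `b₂₁ ≠ 0` makes it nonzero. -/
theorem IsBlockForm.exists_eigenfunctional (hcd : c ^ 2 + d ^ 2 = 1)
    (hU : IsBlockForm c d b₁₁ b₁₂ b₂₁ b₂₂ D U) (hb : b₂₁ ≠ 0) {z : ℂ}
    (hz : z ^ 2 - ((b₁₁ + b₂₂ : ℝ) : ℂ) * z + ((b₁₁ * b₂₂ - b₁₂ * b₂₁ : ℝ) : ℂ) = 0) :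
    ∃ ψ : ℝ × EuclideanSpace ℝ (Fin (m + 2)) →ₗ[ℝ] ℂ, ψ ≠ 0 ∧ ∀ x, ψ (U x) = z * ψ x := by
  let ψ : ℝ × EuclideanSpace ℝ (Fin (m + 2)) →ₗ[ℝ] ℂ :=
    { toFun := fun v => b₂₁ * v.1 + (z - b₁₁) * ((d * v.2 0 - c * v.2 (Fin.last (m + 1)) : ℝ) : ℂ)
      map_add' := fun v w => by simp; ring
      map_smul' := fun r v => by simp; ring }
  have hψ (v) : ψ v =
    b₂₁ * v.1 + (z - b₁₁) * ((d * v.2 0 - c * v.2 (Fin.last (m + 1)) : ℝ) : ℂ) := rfl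
  refine ⟨ψ, fun h0 => hb ?_, fun x => ?_⟩
  · have := congrArg (fun f => f (1, 0)) h0
    simpa [hψ] using this
  · have htan : d * (U x).2 0 - c * (U x).2 (Fin.last (m + 1)) =
        b₂₁ * x.1 + b₂₂ * (d * x.2 0 - c * x.2 (Fin.last (m + 1))) := by
      rw [hU.zero, hU.last]
      linear_combination (b₂₁ * x.1 + b₂₂ * (d * x.2 0 - c * x.2 (Fin.last (m + 1)))) * hcd
    rw [hψ, hψ, htan, hU.fst]
    set l := d * x.2 0 - c * x.2 (Fin.last (m + 1))
    push_cast at hz ⊢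
    linear_combination (-l : ℂ) * hz

end BlockForm


/-! ### Derivatives of the normalization and of the stepsize update. -/

/-- The derivative is `‖w‖⁻¹` times the orthogonal projection onto the complement of `w`. -/
theorem hasFDerivAt_direction {n : ℕ} {w : EuclideanSpace ℝ (Fin n)} (hw : w ≠ 0) :
    ∃ A : EuclideanSpace ℝ (Fin n) →L[ℝ] EuclideanSpace ℝ (Fin n), HasFDerivAt direction A w ∧
      ∀ x, A x = ‖w‖⁻¹ • x - ((‖w‖ ^ 3)⁻¹ * inner ℝ w x) • w := by
  have hw0 : ‖w‖ ≠ 0 := norm_ne_zero_iff.2 hw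
  have h1 := ((hasStrictFDerivAt_norm_sq w).hasFDerivAt).sqrt (pow_ne_zero 2 hw0)
  simp only [Real.sqrt_sq (norm_nonneg _)] at h1
  have h2 := (hasDerivAt_inv hw0).comp_hasFDerivAt w h1
  have h3 := h2.smul (hasFDerivAt_id (𝕜 := ℝ) w)
  refine ⟨_, h3, fun x => ?_⟩
  simp [smul_smul]
  rw [sub_eq_add_neg, ← neg_smul]
  congr 2
  field_simp
  exact neg_smul _ _

theorem hasFDerivAt_inner_diagOp_pow {n : ℕ} (lam : Fin n → ℝ) (k : ℕ)
    (s : ℝ × EuclideanSpace ℝ (Fin n)) :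
    ∃ A : ℝ × EuclideanSpace ℝ (Fin n) →L[ℝ] ℝ,
      HasFDerivAt (fun s : ℝ × EuclideanSpace ℝ (Fin n) => inner ℝ s.2 ((diagOp lam ^ k) s.2)) A s ∧
        ∀ v, A v = 2 * inner ℝ s.2 ((diagOp lam ^ k) v.2) := by
  have h1 : HasFDerivAt (fun s : ℝ × EuclideanSpace ℝ (Fin n) => s.2)
    (ContinuousLinearMap.snd ℝ _ _) s := hasFDerivAt_snd
  have h2 := h1.inner ℝ ((diagOp lam ^ k).hasFDerivAt.comp s h1)
  refine ⟨_, h2, fun v => ?_⟩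
  simp only [ContinuousLinearMap.comp_apply, ContinuousLinearMap.prod_apply,
    fderivInnerCLM_apply, ContinuousLinearMap.coe_snd', Function.comp_apply]
  rw [inner_diagOp_pow, inner_diagOp_pow, two_mul]
  congr 1
  exact Finset.sum_congr rfl fun i _ => by ring

theorem hasFDerivAt_stepsizeUpdate {n : ℕ} (lam : Fin n → ℝ) (η : ℝ)
    (s : ℝ × EuclideanSpace ℝ (Fin n)) (hs : inner ℝ s.2 ((diagOp lam ^ 2) s.2) ≠ 0) :
    ∃ A : ℝ × EuclideanSpace ℝ (Fin n) →L[ℝ] ℝ,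
      HasFDerivAt (fun s : ℝ × EuclideanSpace ℝ (Fin n) => stepsizeUpdate lam η s.1 s.2) A s ∧
        ∀ v, A v = v.1 - v.1 * η * (inner ℝ s.2 ((diagOp lam ^ 3) s.2) /
            inner ℝ s.2 ((diagOp lam ^ 2) s.2)) -
          s.1 * η * ((2 * inner ℝ s.2 ((diagOp lam ^ 3) v.2) *
              inner ℝ s.2 ((diagOp lam ^ 2) s.2) -
            inner ℝ s.2 ((diagOp lam ^ 3) s.2) * (2 * inner ℝ s.2 ((diagOp lam ^ 2) v.2))) /
              inner ℝ s.2 ((diagOp lam ^ 2) s.2) ^ 2) := by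
  obtain ⟨A3, h3, hA3⟩ := hasFDerivAt_inner_diagOp_pow lam 3 s
  obtain ⟨A2, h2, hA2⟩ := hasFDerivAt_inner_diagOp_pow lam 2 s
  have h1 : HasFDerivAt (fun s : ℝ × EuclideanSpace ℝ (Fin n) => s.1)
    (ContinuousLinearMap.fst ℝ _ _) s := hasFDerivAt_fst
  have hinv := (hasDerivAt_inv hs).comp_hasFDerivAt s h2
  have h := (h1.add_const η).sub ((h1.mul_const η).mul (h3.mul hinv))
  refine ⟨_, h, fun v => ?_⟩
  simp [hA3, hA2] at hs ⊢
  field_simp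
  ring

/-! ### The orbit points and the derivative of the stepsize there. -/

section Extremal

variable {m : ℕ} {lam : Fin (m + 2) → ℝ} {L μ c d : ℝ}

theorem inner_extremal_diagOp_pow (hL : L = lam 0) (hμ : μ = lam (Fin.last (m + 1))) (k : ℕ)
    (x : EuclideanSpace ℝ (Fin (m + 2))) :
    inner ℝ (EuclideanSpace.single 0 c + EuclideanSpace.single (Fin.last (m + 1)) d)
      ((diagOp lam ^ k) x) = L ^ k * c * x 0 + μ ^ k * d * x (Fin.last (m + 1)) := by
  rw [inner_add_left, EuclideanSpace.inner_single_left, EuclideanSpace.inner_single_left,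
    diagOp_pow_apply, diagOp_pow_apply, hL, hμ]
  simp
  ring

theorem extremal_zero : (EuclideanSpace.single 0 c + EuclideanSpace.single (Fin.last (m + 1)) d :
    EuclideanSpace ℝ (Fin (m + 2))) 0 = c := by
  simp [(Fin.last_pos (n := m)).ne]

theorem extremal_last : (EuclideanSpace.single 0 c + EuclideanSpace.single (Fin.last (m + 1)) d :
    EuclideanSpace ℝ (Fin (m + 2))) (Fin.last (m + 1)) = d := by
  simp [(Fin.last_pos (n := m)).ne']

theorem extremal_middle {i : Fin (m + 2)} (hi0 : i ≠ 0) (hin : i ≠ Fin.last (m + 1)) :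
    (EuclideanSpace.single 0 c + EuclideanSpace.single (Fin.last (m + 1)) d :
    EuclideanSpace ℝ (Fin (m + 2))) i = 0 := by
  simp [hi0, hin]

theorem norm_extremal (hcd : c ^ 2 + d ^ 2 = 1) :
    ‖(EuclideanSpace.single 0 c + EuclideanSpace.single (Fin.last (m + 1)) d :
    EuclideanSpace ℝ (Fin (m + 2)))‖ = 1 := by
  have h := inner_extremal_diagOp_pow (lam := fun _ : Fin (m + 2) => 1) (c := c) (d := d) rfl rfl 0
    (EuclideanSpace.single 0 c + EuclideanSpace.single (Fin.last (m + 1)) d)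
  rw [extremal_zero, extremal_last, pow_zero, one_apply_eq_self, real_inner_self_eq_norm_sq] at h
  rw [← sq_eq_sq₀ (norm_nonneg _) zero_le_one, h]
  linarith

/-- The coordinates of the two orbit points: squares determined by the two extreme eigenvalues. -/
structure IsExtremalPair (L μ c d : ℝ) : Prop where
  pos : 0 < μ
  lt : μ < L
  sq_left : c ^ 2 * (L ^ 2 + μ ^ 2) = μ ^ 2
  sq_right : d ^ 2 * (L ^ 2 + μ ^ 2) = L ^ 2

theorem IsExtremalPair.add_pos (h : IsExtremalPair L μ c d) : 0 < L + μ := by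
  linarith [h.pos, h.lt]

theorem IsExtremalPair.sq_add_sq (h : IsExtremalPair L μ c d) : c ^ 2 + d ^ 2 = 1 := by
  have h0 : L ^ 2 + μ ^ 2 ≠ 0 := by have := h.pos; positivity
  apply mul_right_cancel₀ h0
  linarith [h.sq_left, h.sq_right]

theorem IsExtremalPair.left_ne_zero (h : IsExtremalPair L μ c d) : c ≠ 0 := by
  rintro rfl
  have := h.sq_left
  have := pow_pos h.pos 2
  simp at *
  linarith

theorem IsExtremalPair.right_ne_zero (h : IsExtremalPair L μ c d) : d ≠ 0 := by
  rintro rfl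
  have := h.sq_right
  have := pow_pos (h.pos.trans h.lt) 2
  simp at *
  linarith

theorem IsExtremalPair.neg_left (h : IsExtremalPair L μ c d) : IsExtremalPair L μ (-c) d :=
  ⟨h.pos, h.lt, by rw [neg_sq]; exact h.sq_left, h.sq_right⟩

theorem IsExtremalPair.ratio (h : IsExtremalPair L μ c d) : L ^ 2 * c ^ 2 = μ ^ 2 * d ^ 2 := by
  have h0 : L ^ 2 + μ ^ 2 ≠ 0 := by have := h.pos; positivity
  apply mul_right_cancel₀ h0
  linear_combination L ^ 2 * h.sq_left - μ ^ 2 * h.sq_right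

theorem IsExtremalPair.inner_two (h : IsExtremalPair L μ c d) :
    L ^ 2 * c * c + μ ^ 2 * d * d ≠ 0 := by
  have h1 := h.ratio
  have h2 : 0 < μ ^ 2 * d ^ 2 := mul_pos (pow_pos h.pos 2) (by
    have := h.right_ne_zero; positivity)
  intro h3
  nlinarith

/-- By `ratio` the two components of `Λz` have equal squares, so `L` and `μ` get equal weight. The
value is the reciprocal of `2 / (L + μ)`, which is what makes that stepsize fixed. -/
theorem IsExtremalPair.rayleigh (h : IsExtremalPair L μ c d) :
    (L ^ 3 * c * c + μ ^ 3 * d * d) / (L ^ 2 * c * c + μ ^ 2 * d * d) = (L + μ) / 2 := by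
  rw [div_eq_div_iff h.inner_two two_ne_zero]
  linear_combination (L - μ) * h.ratio

theorem stepsizeUpdate_extremal (h : IsExtremalPair L μ c d) (hL : L = lam 0)
    (hμ : μ = lam (Fin.last (m + 1))) (η : ℝ) :
    stepsizeUpdate lam η (2 / (L + μ))
      (EuclideanSpace.single 0 c + EuclideanSpace.single (Fin.last (m + 1)) d) = 2 / (L + μ) := by
  have h0 : L + μ ≠ 0 := h.add_pos.ne'
  rw [stepsizeUpdate, inner_extremal_diagOp_pow hL hμ, inner_extremal_diagOp_pow hL hμ,
    extremal_zero, extremal_last, h.rayleigh]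
  field_simp
  ring

/-- At this stepsize `1 - αL` and `1 - αμ` are opposite numbers, so the step only flips the first
component and rescales. -/
theorem sub_diagOp_extremal (h : IsExtremalPair L μ c d) (hL : L = lam 0)
    (hμ : μ = lam (Fin.last (m + 1))) :
    (EuclideanSpace.single 0 c + EuclideanSpace.single (Fin.last (m + 1)) d) -
      (2 / (L + μ)) • diagOp lam
        (EuclideanSpace.single 0 c + EuclideanSpace.single (Fin.last (m + 1)) d) =
      ((L - μ) / (L + μ)) •
        (EuclideanSpace.single 0 (-c) + EuclideanSpace.single (Fin.last (m + 1)) d) := by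
  have h0 : L + μ ≠ 0 := h.add_pos.ne'
  ext i
  simp only [PiLp.sub_apply, PiLp.smul_apply, diagOp_apply, smul_eq_mul]
  by_cases hi0 : i = 0
  · rw [hi0, extremal_zero, extremal_zero, ← hL]
    field_simp
    ring
  · by_cases hin : i = Fin.last (m + 1)
    · rw [hin, extremal_last, extremal_last, ← hμ]
      field_simp
      ring
    · rw [extremal_middle hi0 hin, extremal_middle hi0 hin]
      simp

theorem direction_sub_diagOp_extremal (h : IsExtremalPair L μ c d) (hL : L = lam 0)
    (hμ : μ = lam (Fin.last (m + 1))) :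
    direction ((EuclideanSpace.single 0 c + EuclideanSpace.single (Fin.last (m + 1)) d) -
      (2 / (L + μ)) • diagOp lam
        (EuclideanSpace.single 0 c + EuclideanSpace.single (Fin.last (m + 1)) d)) =
        (EuclideanSpace.single 0 (-c) + EuclideanSpace.single (Fin.last (m + 1)) d) := by
  rw [sub_diagOp_extremal h hL hμ, direction_smul
    (div_pos (sub_pos.2 h.lt) (by linarith [h.pos, h.lt])), direction,
    norm_extremal h.neg_left.sq_add_sq, inv_one, one_smul]

theorem hdmSystem_extremalState (h : IsExtremalPair L μ c d) (hL : L = lam 0)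
    (hμ : μ = lam (Fin.last (m + 1))) (η : ℝ) :
    hdmSystem lam η (extremalState m L μ c d) = extremalState m L μ (-c) d := by
  rw [hdmSystem, extremalState, extremalState]
  simp only
  rw [stepsizeUpdate_extremal h hL hμ, direction_sub_diagOp_extremal h hL hμ]

theorem osgmSystem_extremalState (h : IsExtremalPair L μ c d) (hL : L = lam 0)
    (hμ : μ = lam (Fin.last (m + 1))) (η : ℝ) :
    osgmSystem lam η (extremalState m L μ c d) = extremalState m L μ (-c) d := by
  rw [osgmSystem, extremalState, extremalState]
  simp only
  rw [stepsizeUpdate_extremal h hL hμ, direction_sub_diagOp_extremal h hL hμ]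

/-- Only the tangential coordinate of `v.2` enters: degree-zero homogeneity removes the radial one,
and the middle ones pair with vanishing coordinates of the orbit point. -/
theorem hasFDerivAt_stepsizeUpdate_extremalState (h : IsExtremalPair L μ c d) (hL : L = lam 0)
    (hμ : μ = lam (Fin.last (m + 1))) (η : ℝ) :
    ∃ A : ℝ × EuclideanSpace ℝ (Fin (m + 2)) →L[ℝ] ℝ,
      HasFDerivAt (fun s : ℝ × EuclideanSpace ℝ (Fin (m + 2)) => stepsizeUpdate lam η s.1 s.2) A
        (extremalState m L μ c d) ∧
      ∀ v, A v = (1 - η * (L + μ) / 2) * v.1 +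
        -(η * (L - μ) / ((L + μ) * (c * d))) * (d * v.2 0 - c * v.2 (Fin.last (m + 1))) := by
  have h0 : L + μ ≠ 0 := h.add_pos.ne'
  have hc := h.left_ne_zero
  have hd := h.right_ne_zero
  have hμ0 := h.pos.ne'
  have h2 := h.inner_two
  have hN2 : L ^ 2 * c * c + μ ^ 2 * d * d = 2 * (μ ^ 2 * d ^ 2) := by linarith [h.ratio]
  have hN3 : L ^ 3 * c * c + μ ^ 3 * d * d = (L + μ) * (μ ^ 2 * d ^ 2) := by
    linear_combination L * h.ratio
  obtain ⟨A, hA, hAv⟩ := hasFDerivAt_stepsizeUpdate lam η (extremalState m L μ c d) (by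
    rw [extremalState]
    simp only
    rw [inner_extremal_diagOp_pow hL hμ, extremal_zero, extremal_last]
    exact h2)
  refine ⟨A, hA, fun v => ?_⟩
  rw [hAv, extremalState]
  simp only [inner_extremal_diagOp_pow hL hμ, extremal_zero, extremal_last]
  rw [h.rayleigh, hN2, hN3]
  have key : (2 * (L ^ 3 * c * v.2 0 + μ ^ 3 * d * v.2 (Fin.last (m + 1))) *
      (2 * (μ ^ 2 * d ^ 2)) - (L + μ) * (μ ^ 2 * d ^ 2) *
        (2 * (L ^ 2 * c * v.2 0 + μ ^ 2 * d * v.2 (Fin.last (m + 1))))) /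
        (2 * (μ ^ 2 * d ^ 2)) ^ 2 =
      (L - μ) / (2 * (c * d)) * (d * v.2 0 - c * v.2 (Fin.last (m + 1))) := by
    rw [div_eq_iff (by positivity)]
    field_simp
    linear_combination (v.2 0 * (L - μ)) * h.ratio
  rw [key]
  field_simp
  ring

end Extremal


/-! ### Linearization of both systems along the orbit, and the reflection. -/

section Jacobian

variable {m : ℕ} {lam : Fin (m + 2) → ℝ} {L μ c d : ℝ}

/-- One computation for both systems: `β` is the stepsize passed on and `a` the one used in the
gradient step. HDM takes `a = β`, OSGM-H takes `a` to be the first coordinate. -/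
theorem hasFDerivAt_prod_direction_sub_diagOp (h : IsExtremalPair L μ c d) (hL : L = lam 0)
    (hμ : μ = lam (Fin.last (m + 1))) {β a : ℝ × EuclideanSpace ℝ (Fin (m + 2)) → ℝ}
    {B A : ℝ × EuclideanSpace ℝ (Fin (m + 2)) →L[ℝ] ℝ}
    (hβ : HasFDerivAt β B (extremalState m L μ c d))
    (ha : HasFDerivAt a A (extremalState m L μ c d))
    (ha0 : a (extremalState m L μ c d) = 2 / (L + μ)) :
    ∃ T : ℝ × EuclideanSpace ℝ (Fin (m + 2)) →L[ℝ] ℝ × EuclideanSpace ℝ (Fin (m + 2)),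
      HasFDerivAt (fun s => (β s, direction (s.2 - a s • diagOp lam s.2))) T
        (extremalState m L μ c d) ∧
      ∀ v, (T v).1 = B v ∧
        (T v).2 0 = -(d * (d * v.2 0 - c * v.2 (Fin.last (m + 1)) +
          A v * (c * d * (L + μ) ^ 2 / (L - μ)))) ∧
        (T v).2 (Fin.last (m + 1)) = -c * (d * v.2 0 - c * v.2 (Fin.last (m + 1)) +
          A v * (c * d * (L + μ) ^ 2 / (L - μ))) ∧
        ∀ i, i ≠ 0 → i ≠ Fin.last (m + 1) →
          (T v).2 i = (L + μ - 2 * lam i) / (L - μ) * v.2 i := by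
  have h0 : L + μ ≠ 0 := h.add_pos.ne'
  have hsub : L - μ ≠ 0 := (sub_pos.2 h.lt).ne'
  have hk : 0 < (L - μ) / (L + μ) := div_pos (sub_pos.2 h.lt) h.add_pos
  have hcd := h.sq_add_sq
  have h1 : HasFDerivAt (fun s : ℝ × EuclideanSpace ℝ (Fin (m + 2)) => s.2)
    (ContinuousLinearMap.snd ℝ _ _) (extremalState m L μ c d) := hasFDerivAt_snd
  have hw := h1.sub (ha.smul ((diagOp lam).hasFDerivAt.comp (extremalState m L μ c d) h1))
  have hw0 : (extremalState m L μ c d).2 -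
      a (extremalState m L μ c d) • diagOp lam (extremalState m L μ c d).2 =
      ((L - μ) / (L + μ)) •
        (EuclideanSpace.single 0 (-c) + EuclideanSpace.single (Fin.last (m + 1)) d) := by
    rw [ha0]
    exact sub_diagOp_extremal h hL hμ
  have hnorm : ‖((L - μ) / (L + μ)) • (EuclideanSpace.single 0 (-c) +
      EuclideanSpace.single (Fin.last (m + 1)) d : EuclideanSpace ℝ (Fin (m + 2)))‖ =
      (L - μ) / (L + μ) := by
    rw [norm_smul, norm_extremal h.neg_left.sq_add_sq, mul_one, Real.norm_of_nonneg hk.le]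
  obtain ⟨P, hP, hPv⟩ := hasFDerivAt_direction (w := ((L - μ) / (L + μ)) •
    (EuclideanSpace.single 0 (-c) + EuclideanSpace.single (Fin.last (m + 1)) d :
      EuclideanSpace ℝ (Fin (m + 2)))) (by rw [← norm_ne_zero_iff, hnorm]; exact hk.ne')
  rw [← hw0] at hP
  have hT := hβ.prodMk (hP.comp (extremalState m L μ c d) hw)
  have hinner (x : EuclideanSpace ℝ (Fin (m + 2))) :
      inner ℝ (EuclideanSpace.single 0 (-c) + EuclideanSpace.single (Fin.last (m + 1)) d) x =
        -c * x 0 + d * x (Fin.last (m + 1)) := by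
    simpa using inner_extremal_diagOp_pow (c := -c) (d := d) hL hμ 0 x
  refine ⟨_, hT, fun v => ⟨rfl, ?_⟩⟩
  simp only [ContinuousLinearMap.prod_apply, ContinuousLinearMap.comp_apply]
  rw [hPv, hnorm, inner_smul_left, hinner]
  set x := ((ContinuousLinearMap.snd ℝ ℝ (EuclideanSpace ℝ (Fin (m + 2))) -
    (a (extremalState m L μ c d) • (diagOp lam).comp
      (ContinuousLinearMap.snd ℝ ℝ (EuclideanSpace ℝ (Fin (m + 2)))) +
      A.smulRight ((⇑(diagOp lam) ∘ fun s => s.2) (extremalState m L μ c d)))) v) with hx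
  have hxi (i : Fin (m + 2)) : x i = v.2 i - (2 / (L + μ) * (lam i * v.2 i) +
      A v * (lam i * (EuclideanSpace.single 0 c + EuclideanSpace.single (Fin.last (m + 1)) d :
        EuclideanSpace ℝ (Fin (m + 2))) i)) := by
    rw [hx, ha0]
    simp [diagOp_apply, extremalState]
    split_ifs <;> ring
  have hx0 := hxi 0
  have hxn := hxi (Fin.last (m + 1))
  rw [extremal_zero, ← hL] at hx0
  rw [extremal_last, ← hμ] at hxn
  -- The image direction is `(-c, d)`, with unit tangent `(d, c)`; within the extremal plane only
  -- this component survives the projection.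
  have htan : d * x 0 + c * x (Fin.last (m + 1)) = -((L - μ) / (L + μ)) *
      (d * v.2 0 - c * v.2 (Fin.last (m + 1)) + A v * (c * d * (L + μ) ^ 2 / (L - μ))) := by
    rw [hx0, hxn]
    field_simp
    ring
  simp only [PiLp.sub_apply, PiLp.smul_apply, smul_eq_mul, RCLike.conj_to_real]
  refine ⟨?_, ?_, fun i hi0 hin => ?_⟩
  · rw [extremal_zero]
    have : d * (d * v.2 0 - c * v.2 (Fin.last (m + 1)) + A v * (c * d * (L + μ) ^ 2 / (L - μ))) =
        -(d * (d * x 0 + c * x (Fin.last (m + 1))) / ((L - μ) / (L + μ))) := by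
      rw [htan]
      field_simp
    rw [this]
    field_simp
    linear_combination (-x 0) * hcd
  · rw [extremal_last]
    have : -c * (d * v.2 0 - c * v.2 (Fin.last (m + 1)) + A v * (c * d * (L + μ) ^ 2 / (L - μ))) =
        c * (d * x 0 + c * x (Fin.last (m + 1))) / ((L - μ) / (L + μ)) := by
      rw [htan]
      field_simp
    rw [this]
    field_simp
    linear_combination (-x (Fin.last (m + 1))) * hcd
  · rw [extremal_middle hi0 hin, hxi, extremal_middle hi0 hin]
    field_simp
    ring

/-- The reflection of the first coordinate. -/
noncomputable def reflectFirst (m : ℕ) :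
    ℝ × EuclideanSpace ℝ (Fin (m + 2)) →L[ℝ] ℝ × EuclideanSpace ℝ (Fin (m + 2)) :=
  (ContinuousLinearMap.id ℝ ℝ).prodMap (diagOp (Function.update 1 0 (-1)))

theorem reflectFirst_fst (v : ℝ × EuclideanSpace ℝ (Fin (m + 2))) :
    (reflectFirst m v).1 = v.1 := rfl

theorem reflectFirst_zero (v : ℝ × EuclideanSpace ℝ (Fin (m + 2))) :
    (reflectFirst m v).2 0 = -v.2 0 := by
  change diagOp _ v.2 0 = _
  simp [diagOp_apply]

theorem reflectFirst_of_ne (v : ℝ × EuclideanSpace ℝ (Fin (m + 2))) {i : Fin (m + 2)}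
    (hi : i ≠ 0) : (reflectFirst m v).2 i = v.2 i := by
  change diagOp _ v.2 i = _
  simp [diagOp_apply, hi]

/-- The matrix of the linearization at an orbit point composed with the reflection, for a system
that combines the derivative of the updated stepsize with the stepsize derivative `A`. -/
theorem isBlockForm_reflectFirst {T : ℝ × EuclideanSpace ℝ (Fin (m + 2)) →L[ℝ]
      ℝ × EuclideanSpace ℝ (Fin (m + 2))} {B A : ℝ × EuclideanSpace ℝ (Fin (m + 2)) →L[ℝ] ℝ}
    {b₁₁ b₁₂ a₁ a₂ r : ℝ} {D : Fin (m + 2) → ℝ}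
    (hB : ∀ v, B v = b₁₁ * v.1 + b₁₂ * (d * v.2 0 - c * v.2 (Fin.last (m + 1))))
    (hA : ∀ v, A v = a₁ * v.1 + a₂ * (d * v.2 0 - c * v.2 (Fin.last (m + 1))))
    (hT : ∀ v, (T v).1 = B v ∧
        (T v).2 0 = -(d * (d * v.2 0 - c * v.2 (Fin.last (m + 1)) + A v * r)) ∧
        (T v).2 (Fin.last (m + 1)) = -c * (d * v.2 0 - c * v.2 (Fin.last (m + 1)) + A v * r) ∧
        ∀ i, i ≠ 0 → i ≠ Fin.last (m + 1) → (T v).2 i = D i * v.2 i) :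
    IsBlockForm c d b₁₁ b₁₂ (a₁ * r) (1 + a₂ * r) D (reflectFirst m ∘L T) where
  fst v := by
    rw [ContinuousLinearMap.comp_apply, reflectFirst_fst, (hT v).1, hB]
  zero v := by
    rw [ContinuousLinearMap.comp_apply, reflectFirst_zero, (hT v).2.1, hA]
    ring
  last v := by
    rw [ContinuousLinearMap.comp_apply, reflectFirst_of_ne _ (Fin.last_pos).ne', (hT v).2.2.1, hA]
    ring
  middle v i hi0 hin := by
    rw [ContinuousLinearMap.comp_apply, reflectFirst_of_ne _ hi0, (hT v).2.2.2 i hi0 hin]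

theorem reflectFirst_reflectFirst (v : ℝ × EuclideanSpace ℝ (Fin (m + 2))) :
    reflectFirst m (reflectFirst m v) = v := by
  apply stateProd_ext
  · rfl
  · rw [reflectFirst_zero, reflectFirst_zero, neg_neg]
  · rw [reflectFirst_of_ne _ (Fin.last_pos).ne', reflectFirst_of_ne _ (Fin.last_pos).ne']
  · intro i hi0 _
    rw [reflectFirst_of_ne _ hi0, reflectFirst_of_ne _ hi0]

end Jacobian


/-! ### Spectral radii of the products of Jacobians, and stability of HDM. -/

section Spectral

variable {m : ℕ} {lam : Fin (m + 2) → ℝ} {L μ c d : ℝ}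

theorem exists_hasFDerivAt_osgmSystem (h : IsExtremalPair L μ c d) (hL : L = lam 0)
    (hμ : μ = lam (Fin.last (m + 1))) (η : ℝ) :
    ∃ T, HasFDerivAt (osgmSystem lam η) T (extremalState m L μ c d) ∧
      IsBlockForm c d (1 - η * (L + μ) / 2) (-(η * (L - μ) / ((L + μ) * (c * d))))
        (c * d * (L + μ) ^ 2 / (L - μ)) 1 (fun i => (L + μ - 2 * lam i) / (L - μ))
        (reflectFirst m ∘L T) := by
  obtain ⟨B, hB, hBv⟩ := hasFDerivAt_stepsizeUpdate_extremalState h hL hμ η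
  obtain ⟨T, hT, hTv⟩ := hasFDerivAt_prod_direction_sub_diagOp h hL hμ hB
    (hasFDerivAt_fst (𝕜 := ℝ)) rfl
  refine ⟨T, hT, ?_⟩
  have := isBlockForm_reflectFirst (a₁ := 1) (a₂ := 0)
    (D := fun i => (L + μ - 2 * lam i) / (L - μ)) hBv (fun v => by simp) hTv
  simpa using this

theorem exists_hasFDerivAt_hdmSystem (h : IsExtremalPair L μ c d) (hL : L = lam 0)
    (hμ : μ = lam (Fin.last (m + 1))) (η : ℝ) :
    ∃ T, HasFDerivAt (hdmSystem lam η) T (extremalState m L μ c d) ∧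
      IsBlockForm c d (1 - η * (L + μ) / 2) (-(η * (L - μ) / ((L + μ) * (c * d))))
        ((1 - η * (L + μ) / 2) * (c * d * (L + μ) ^ 2 / (L - μ))) (1 - η * (L + μ))
        (fun i => (L + μ - 2 * lam i) / (L - μ)) (reflectFirst m ∘L T) := by
  obtain ⟨B, hB, hBv⟩ := hasFDerivAt_stepsizeUpdate_extremalState h hL hμ η
  obtain ⟨T, hT, hTv⟩ := hasFDerivAt_prod_direction_sub_diagOp h hL hμ hB hB
    (stepsizeUpdate_extremal h hL hμ η)
  refine ⟨T, hT, ?_⟩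
  have := isBlockForm_reflectFirst (D := fun i => (L + μ - 2 * lam i) / (L - μ)) hBv hBv hTv
  have hb : 1 + -(η * (L - μ) / ((L + μ) * (c * d))) * (c * d * (L + μ) ^ 2 / (L - μ)) =
      1 - η * (L + μ) := by
    have h0 : L + μ ≠ 0 := h.add_pos.ne'
    have hsub : L - μ ≠ 0 := (sub_pos.2 h.lt).ne'
    have hc := h.left_ne_zero
    have hd := h.right_ne_zero
    field_simp
    ring
  rwa [hb] at this

/-- With `R` the reflection, the two forms give `T₁ R = R T₂`, hence `T₁ T₂ = T₁ R R T₂ = (R T₂)²`.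
The off-diagonal entries change sign because `R` reverses the tangential coordinate. -/
theorem comp_eq_sq_of_isBlockForm {b₁₁ b₁₂ b₂₁ b₂₂ : ℝ} {D : Fin (m + 2) → ℝ}
    {T₁ T₂ : ℝ × EuclideanSpace ℝ (Fin (m + 2)) →L[ℝ] ℝ × EuclideanSpace ℝ (Fin (m + 2))}
    (h₁ : IsBlockForm c d b₁₁ b₁₂ b₂₁ b₂₂ D (reflectFirst m ∘L T₁))
    (h₂ : IsBlockForm (-c) d b₁₁ (-b₁₂) (-b₂₁) b₂₂ D (reflectFirst m ∘L T₂)) :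
    T₁ ∘L T₂ = (reflectFirst m ∘L T₂) ∘L (reflectFirst m ∘L T₂) := by
  have hl : Fin.last (m + 1) ≠ 0 := (Fin.last_pos).ne'
  have key (x) : (reflectFirst m ∘L T₁) (reflectFirst m x) =
      reflectFirst m ((reflectFirst m ∘L T₂) x) := by
    apply stateProd_ext
    · rw [h₁.fst, reflectFirst_fst, reflectFirst_fst, reflectFirst_zero, reflectFirst_of_ne _ hl,
        h₂.fst]
      ring
    · rw [h₁.zero, reflectFirst_fst, reflectFirst_zero, reflectFirst_zero, reflectFirst_of_ne _ hl,
        h₂.zero]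
      ring
    · rw [h₁.last, reflectFirst_fst, reflectFirst_zero, reflectFirst_of_ne _ hl,
        reflectFirst_of_ne _ hl, h₂.last]
      ring
    · intro i hi0 hin
      rw [h₁.middle _ i hi0 hin, reflectFirst_of_ne _ hi0, reflectFirst_of_ne _ hi0,
        h₂.middle _ i hi0 hin]
  have hcomm (y) : T₁ (reflectFirst m y) = reflectFirst m (T₂ y) := by
    simpa only [ContinuousLinearMap.comp_apply, reflectFirst_reflectFirst] using
      congrArg (reflectFirst m) (key y)
  refine ContinuousLinearMap.ext fun x => ?_
  simp only [ContinuousLinearMap.comp_apply]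
  rw [← hcomm, reflectFirst_reflectFirst]

theorem jacobianMatrix_mul_jacobianMatrix {n : ℕ}
    {F : ℝ × EuclideanSpace ℝ (Fin n) → ℝ × EuclideanSpace ℝ (Fin n)}
    {T₁ T₂ : ℝ × EuclideanSpace ℝ (Fin n) →L[ℝ] ℝ × EuclideanSpace ℝ (Fin n)}
    {s₁ s₂ : ℝ × EuclideanSpace ℝ (Fin n)} (h₁ : HasFDerivAt F T₁ s₁) (h₂ : HasFDerivAt F T₂ s₂) :
    jacobianMatrix F s₁ * jacobianMatrix F s₂ =
      LinearMap.toMatrix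
        ((Module.Basis.singleton Unit ℝ).prod (EuclideanSpace.basisFun (Fin n) ℝ).toBasis)
        ((Module.Basis.singleton Unit ℝ).prod (EuclideanSpace.basisFun (Fin n) ℝ).toBasis)
        (T₁ ∘L T₂).toLinearMap := by
  rw [jacobianMatrix, jacobianMatrix, h₁.fderiv, h₂.fderiv, ← LinearMap.toMatrix_comp]
  rfl

theorem mem_spectrum_jacobianMatrix_mul_iff {n : ℕ}
    {F : ℝ × EuclideanSpace ℝ (Fin n) → ℝ × EuclideanSpace ℝ (Fin n)}
    {T₁ T₂ U : ℝ × EuclideanSpace ℝ (Fin n) →L[ℝ] ℝ × EuclideanSpace ℝ (Fin n)}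
    {s₁ s₂ : ℝ × EuclideanSpace ℝ (Fin n)} (h₁ : HasFDerivAt F T₁ s₁) (h₂ : HasFDerivAt F T₂ s₂)
    (hU : T₁ ∘L T₂ = U ∘L U) (z : ℂ) :
    z ∈ spectrum ℂ ((jacobianMatrix F s₁ * jacobianMatrix F s₂).map Complex.ofReal) ↔
      ∃ w : ℂ, (∃ ψ : ℝ × EuclideanSpace ℝ (Fin n) →ₗ[ℝ] ℂ, ψ ≠ 0 ∧ ∀ x, ψ (U x) = w * ψ x) ∧
        w ^ 2 = z := by
  rw [jacobianMatrix_mul_jacobianMatrix h₁ h₂, hU, ContinuousLinearMap.toLinearMap_comp,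
    LinearMap.toMatrix_comp _
      ((Module.Basis.singleton Unit ℝ).prod (EuclideanSpace.basisFun (Fin n) ℝ).toBasis),
    mem_spectrum_map_ofReal_mul_self_iff]
  simp only [mem_spectrum_map_toMatrix_iff]
  rfl

/-- The affine map `λ ↦ (L + μ - 2λ) / (L - μ)` sends `L` to `-1` and `μ` to `1`; distinctness of
the eigenvalues makes the bound strict. -/
theorem abs_middle_lt_one (hL : L = lam 0) (hμ : μ = lam (Fin.last (m + 1)))
    (hlam : StrictAnti lam) {i : Fin (m + 2)} (hi0 : i ≠ 0) (hin : i ≠ Fin.last (m + 1)) :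
    |(L + μ - 2 * lam i) / (L - μ)| < 1 := by
  have h1 : lam i < L := hL ▸ hlam (Fin.pos_of_ne_zero hi0)
  have h2 : μ < lam i := hμ ▸ hlam (Fin.lt_last_iff_ne_last.2 hin)
  rw [abs_lt, lt_div_iff₀ (by linarith), div_lt_iff₀ (by linarith)]
  constructor <;> linarith

theorem realSpectralRadius_hdmSystem_lt_one (h : IsExtremalPair L μ c d) (hL : L = lam 0)
    (hμ : μ = lam (Fin.last (m + 1))) (hlam : StrictAnti lam) {η : ℝ} (hη : 0 < η)
    (hηL : η ≤ 1 / L) :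
    realSpectralRadius (jacobianMatrix (hdmSystem lam η) (extremalState m L μ c d) *
      jacobianMatrix (hdmSystem lam η) (extremalState m L μ (-c) d)) < 1 := by
  obtain ⟨T₁, hT₁, hB₁⟩ := exists_hasFDerivAt_hdmSystem h hL hμ η
  obtain ⟨T₂, hT₂, hB₂⟩ := exists_hasFDerivAt_hdmSystem h.neg_left hL hμ η
  have hU : T₁ ∘L T₂ = (reflectFirst m ∘L T₂) ∘L (reflectFirst m ∘L T₂) := by
    refine comp_eq_sq_of_isBlockForm hB₁ ?_
    convert! hB₂ using 1
    · rw [neg_mul, mul_neg, div_neg]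
    · ring
  have h0 := h.add_pos
  have hu0 : 0 < η * (L + μ) / 2 := by positivity
  have hu1 : η * (L + μ) / 2 < 1 := by
    have hLpos := h.pos.trans h.lt
    rw [le_div_iff₀ hLpos] at hηL
    nlinarith [h.lt]
  refine realSpectralRadius_lt_one_of_forall fun z hz => ?_
  obtain ⟨w, ⟨ψ, hψ, hw⟩, rfl⟩ := (mem_spectrum_jacobianMatrix_mul_iff hT₁ hT₂ hU z).1 hz
  have hwlt : ‖w‖ < 1 := by
    rcases IsBlockForm.eigenvalue_cases (U := (reflectFirst m ∘L T₂).toLinearMap)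
      h.neg_left.sq_add_sq hB₂ hψ hw with hw0 | ⟨i, hi0, hin, hwi⟩ | hwq
    · simp [hw0]
    · rw [hwi, Complex.norm_real]
      exact abs_middle_lt_one hL hμ hlam hi0 hin
    · have hsub : L - μ ≠ 0 := (sub_pos.2 h.lt).ne'
      have hc := h.left_ne_zero
      have hd := h.right_ne_zero
      -- The block has the form `(b, s; b r, 1 + s r)`, so its determinant is just `b`.
      have hdet : (1 - η * (L + μ) / 2) * (1 - η * (L + μ)) -
          -(η * (L - μ) / ((L + μ) * (-c * d))) *
            ((1 - η * (L + μ) / 2) * (-c * d * (L + μ) ^ 2 / (L - μ))) =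
          1 - η * (L + μ) / 2 := by
        field_simp
        ring
      rw [hdet] at hwq
      exact norm_lt_one_of_root (by linarith) (by linarith) (by linarith) hwq
  rw [norm_pow]
  exact pow_lt_one₀ (norm_nonneg _) hwlt two_ne_zero

theorem realSpectralRadius_osgmSystem (h : IsExtremalPair L μ c d) (hL : L = lam 0)
    (hμ : μ = lam (Fin.last (m + 1))) (hlam : StrictAnti lam) {η : ℝ} (hη : 0 < η)
    (hηL : η ≤ 1 / L) :
    realSpectralRadius (jacobianMatrix (osgmSystem lam η) (extremalState m L μ c d) *
      jacobianMatrix (osgmSystem lam η) (extremalState m L μ (-c) d)) =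
        ENNReal.ofReal (1 + η * (L + μ) / 2) := by
  obtain ⟨T₁, hT₁, hB₁⟩ := exists_hasFDerivAt_osgmSystem h hL hμ η
  obtain ⟨T₂, hT₂, hB₂⟩ := exists_hasFDerivAt_osgmSystem h.neg_left hL hμ η
  have hU : T₁ ∘L T₂ = (reflectFirst m ∘L T₂) ∘L (reflectFirst m ∘L T₂) := by
    refine comp_eq_sq_of_isBlockForm hB₁ ?_
    convert! hB₂ using 1
    · rw [neg_mul, mul_neg, div_neg]
    · ring
  have h0 := h.add_pos
  have hsub : L - μ ≠ 0 := (sub_pos.2 h.lt).ne'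
  have hc := h.left_ne_zero
  have hd := h.right_ne_zero
  have hu0 : 0 < η * (L + μ) / 2 := by positivity
  have hu1 : η * (L + μ) / 2 < 1 := by
    have hLpos := h.pos.trans h.lt
    rw [le_div_iff₀ hLpos] at hηL
    nlinarith [h.lt]
  have hdet : (1 - η * (L + μ) / 2) * 1 - -(η * (L - μ) / ((L + μ) * (-c * d))) *
      (-c * d * (L + μ) ^ 2 / (L - μ)) = 1 + η * (L + μ) / 2 := by
    field_simp
    ring
  -- With `u = η(L + μ)/2`, the discriminant is `u² - 8u`, negative since `0 < u < 1`.
  have hdisc : (1 - η * (L + μ) / 2 + 1) ^ 2 < 4 * (1 + η * (L + μ) / 2) := by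
    nlinarith
  refine realSpectralRadius_eq_of_forall_le (fun z hz => ?_) ?_
  · obtain ⟨w, ⟨ψ, hψ, hw⟩, rfl⟩ := (mem_spectrum_jacobianMatrix_mul_iff hT₁ hT₂ hU z).1 hz
    rw [norm_pow]
    rcases IsBlockForm.eigenvalue_cases (U := (reflectFirst m ∘L T₂).toLinearMap)
      h.neg_left.sq_add_sq hB₂ hψ hw with hw0 | ⟨i, hi0, hin, hwi⟩ | hwq
    · rw [hw0]
      simp
      linarith
    · rw [hwi, Complex.norm_real]
      have := pow_lt_one₀ (abs_nonneg _) (abs_middle_lt_one hL hμ hlam hi0 hin) two_ne_zero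
      rw [Real.norm_eq_abs]
      linarith
    · rw [hdet] at hwq
      exact (normSq_of_root_of_im_ne_zero hwq (im_ne_zero_of_root hdisc hwq)).le
  -- The radius is attained at the square of a nonreal root of the block, whose squared modulus is
  -- the determinant.
  · obtain ⟨w, hw, hi⟩ := exists_root_of_discrim_neg hdisc
    refine ⟨w ^ 2, (mem_spectrum_jacobianMatrix_mul_iff hT₁ hT₂ hU _).2 ⟨w, ?_, rfl⟩, ?_⟩
    · refine IsBlockForm.exists_eigenfunctional (U := (reflectFirst m ∘L T₂).toLinearMap)
        h.neg_left.sq_add_sq hB₂ ?_ ?_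
      · exact div_ne_zero (mul_ne_zero (mul_ne_zero (neg_ne_zero.2 hc) hd)
          (pow_ne_zero 2 h0.ne')) hsub
      · rw [hdet]
        exact hw
    · rw [norm_pow, normSq_of_root_of_im_ne_zero hw hi]

theorem asymptoticallyStableOn_hdmSystem (h : IsExtremalPair L μ c d) (hL : L = lam 0)
    (hμ : μ = lam (Fin.last (m + 1))) (hlam : StrictAnti lam) {η : ℝ} (hη : 0 < η)
    (hηL : η ≤ 1 / L) :
    AsymptoticallyStableOn (hdmSystem lam η) (stateSpace (m + 2))
      {extremalState m L μ c d, extremalState m L μ (-c) d} := by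
  obtain ⟨T₁, hT₁, -⟩ := exists_hasFDerivAt_hdmSystem h hL hμ η
  obtain ⟨T₂, hT₂, -⟩ := exists_hasFDerivAt_hdmSystem h.neg_left hL hμ η
  have hlt := realSpectralRadius_hdmSystem_lt_one h hL hμ hlam hη hηL
  rw [jacobianMatrix_mul_jacobianMatrix hT₁ hT₂] at hlt
  refine asymptoticallyStableOn_of_tendsto_pow hT₁ hT₂ (hdmSystem_extremalState h hL hμ η) ?_
    (tendsto_pow_of_realSpectralRadius_toMatrix_lt_one _ _ hlt) _
  rw [hdmSystem_extremalState h.neg_left hL hμ η, neg_neg]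

end Spectral


/-! ### Instability of OSGM-H through a planar source. -/

/-- A nonreal eigenvalue `z` has a left eigenvector that identifies `ℝ²` with `ℂ` and turns `T` into
multiplication by `z`; so `T` expands all vectors by the same factor `‖z‖ > 1`. -/
theorem exists_le_dist_iterate_of_discrim_neg {H : ℝ × ℝ → ℝ × ℝ} {T : ℝ × ℝ →L[ℝ] ℝ × ℝ}
    {p : ℝ × ℝ} {b₁₁ b₁₂ b₂₁ b₂₂ : ℝ} (hH : HasFDerivAt H T p) (hp : H p = p)
    (hT : ∀ v, T v = (b₁₁ * v.1 + b₁₂ * v.2, b₂₁ * v.1 + b₂₂ * v.2)) (hb : b₂₁ ≠ 0)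
    (hdisc : (b₁₁ + b₂₂) ^ 2 < 4 * (b₁₁ * b₂₂ - b₁₂ * b₂₁)) (hdet : 1 < b₁₁ * b₂₂ - b₁₂ * b₂₁) :
    ∃ ε > 0, ∀ x, x ≠ p → ∃ k : ℕ, ε ≤ dist (H^[k] x) p := by
  obtain ⟨z, hz, hi⟩ := exists_root_of_discrim_neg hdisc
  have hnorm := normSq_of_root_of_im_ne_zero hz hi
  let ψ : ℝ × ℝ →ₗ[ℝ] ℂ :=
    { toFun := fun v => b₂₁ * v.1 + (z - b₁₁) * v.2
      map_add' := fun v w => by simp; ring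
      map_smul' := fun r v => by simp; ring }
  have hψ (v) : ψ v = b₂₁ * v.1 + (z - b₁₁) * v.2 := rfl
  have hker : LinearMap.ker ψ = ⊥ := by
    refine LinearMap.ker_eq_bot'.2 fun v hv => ?_
    have him := congrArg Complex.im hv
    have hre := congrArg Complex.re hv
    simp [hψ] at him hre
    have hv2 := him.resolve_left hi
    rw [hv2] at hre
    exact Prod.ext (by simpa [hb] using hre) hv2
  obtain ⟨K, _, hK⟩ := ψ.exists_antilipschitzWith hker
  refine exists_le_dist_iterate_of_expanding hH hp (LinearMap.toContinuousLinearMap ψ)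
    K.coe_nonneg (fun v => ?_) (ρ := ‖z‖) ?_ fun v => ?_
  · simpa using hK.le_mul_dist v 0
  · by_contra! hle
    nlinarith [norm_nonneg z]
  · rw [← norm_mul]
    refine le_of_eq (congrArg _ ?_)
    change z * ψ v = ψ (T v)
    rw [hψ, hψ, hT]
    push_cast at hz ⊢
    linear_combination (v.2 : ℂ) * hz

/-- The dynamics of OSGM-H in the coordinates `(α, (z₁ / zₙ)²)` on the states whose direction lies
in the plane of the two extreme eigenvectors. -/
noncomputable def planarOsgm (L μ η : ℝ) (v : ℝ × ℝ) : ℝ × ℝ :=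
  (v.1 + η - v.1 * η * ((L ^ 3 * v.2 + μ ^ 3) / (L ^ 2 * v.2 + μ ^ 2)),
    v.2 * ((1 - v.1 * L) / (1 - v.1 * μ)) ^ 2)

section Planar

variable {L μ η : ℝ}

theorem planarOsgm_fixed (hμ : 0 < μ) (hL : μ < L) :
    planarOsgm L μ η (2 / (L + μ), μ ^ 2 / L ^ 2) = (2 / (L + μ), μ ^ 2 / L ^ 2) := by
  have hL0 : L ≠ 0 := (hμ.trans hL).ne'
  have h0 : L + μ ≠ 0 := by linarith
  have hsub : L - μ ≠ 0 := (sub_pos.2 hL).ne'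
  have h1 : 1 - 2 / (L + μ) * L = -((L - μ) / (L + μ)) := by field_simp; ring
  have h2 : 1 - 2 / (L + μ) * μ = (L - μ) / (L + μ) := by field_simp; ring
  rw [planarOsgm]
  simp only [h1, h2]
  refine Prod.ext ?_ ?_
  · simp only
    field_simp
    ring
  · simp only
    rw [neg_div, div_self (div_ne_zero hsub h0)]
    ring

/-- This matrix has the same trace and determinant as the 2×2 block of OSGM-H, the tangential
coordinate being replaced by the squared ratio. -/
theorem hasFDerivAt_planarOsgm (hμ : 0 < μ) (hL : μ < L) :
    ∃ T : ℝ × ℝ →L[ℝ] ℝ × ℝ,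
      HasFDerivAt (planarOsgm L μ η) T (2 / (L + μ), μ ^ 2 / L ^ 2) ∧
      ∀ v, T v = ((1 - η * (L + μ) / 2) * v.1 +
          -(η * L ^ 2 * (L - μ) / (2 * μ ^ 2 * (L + μ))) * v.2,
        2 * μ ^ 2 * (L + μ) ^ 2 / (L ^ 2 * (L - μ)) * v.1 + 1 * v.2) := by
  have hL0 : 0 < L := hμ.trans hL
  have h0 : L + μ ≠ 0 := by linarith
  have hsub : L - μ ≠ 0 := (sub_pos.2 hL).ne'
  set p : ℝ × ℝ := (2 / (L + μ), μ ^ 2 / L ^ 2) with hp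
  have hden : L ^ 2 * p.2 + μ ^ 2 = 2 * μ ^ 2 := by rw [hp]; simp only; field_simp; ring
  have hnum : L ^ 3 * p.2 + μ ^ 3 = μ ^ 2 * (L + μ) := by rw [hp]; simp only; field_simp
  have h1 : 1 - p.1 * L = -((L - μ) / (L + μ)) := by rw [hp]; simp only; field_simp; ring
  have h2 : 1 - p.1 * μ = (L - μ) / (L + μ) := by rw [hp]; simp only; field_simp; ring
  have hf : HasFDerivAt (fun v : ℝ × ℝ => v.1) (ContinuousLinearMap.fst ℝ ℝ ℝ) p := hasFDerivAt_fst
  have hs : HasFDerivAt (fun v : ℝ × ℝ => v.2) (ContinuousLinearMap.snd ℝ ℝ ℝ) p := hasFDerivAt_snd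
  have hdinv := (hasDerivAt_inv (x := L ^ 2 * p.2 + μ ^ 2) (by rw [hden]; positivity)
    ).comp_hasFDerivAt p ((hs.const_mul (L ^ 2)).add_const (μ ^ 2))
  have hαinv := (hasDerivAt_inv (x := 1 - p.1 * μ) (by rw [h2]; exact div_ne_zero hsub h0)
    ).comp_hasFDerivAt p ((hf.mul_const μ).const_sub 1)
  have hA := (hf.add_const η).sub ((hf.mul_const η).mul
    (((hs.const_mul (L ^ 3)).add_const (μ ^ 3)).mul hdinv))
  have hB := hs.mul ((((hf.mul_const L).const_sub 1).mul hαinv).pow 2)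
  refine ⟨_, hA.prodMk hB, fun v => ?_⟩
  refine Prod.ext ?_ ?_
  · simp [hden, hnum, h1, h2]
    simp only [hp]
    field_simp
    ring
  · simp [hden, hnum, h1, h2]
    simp only [hp]
    field_simp
    ring

theorem exists_le_dist_iterate_planarOsgm (hμ : 0 < μ) (hL : μ < L) (hη : 0 < η)
    (hηL : η ≤ 1 / L) :
    ∃ ε > 0, ∀ x, x ≠ (2 / (L + μ), μ ^ 2 / L ^ 2) →
      ∃ k : ℕ, ε ≤ dist ((planarOsgm L μ η)^[k] x) (2 / (L + μ), μ ^ 2 / L ^ 2) := by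
  obtain ⟨T, hT, hTv⟩ := hasFDerivAt_planarOsgm (η := η) hμ hL
  have hL0 : 0 < L := hμ.trans hL
  have h0 : 0 < L + μ := by linarith
  have hsub : L - μ ≠ 0 := (sub_pos.2 hL).ne'
  have hu0 : 0 < η * (L + μ) / 2 := by positivity
  have hu1 : η * (L + μ) / 2 < 1 := by
    rw [le_div_iff₀ hL0] at hηL
    nlinarith
  have hdet : (1 - η * (L + μ) / 2) * 1 - -(η * L ^ 2 * (L - μ) / (2 * μ ^ 2 * (L + μ))) *
      (2 * μ ^ 2 * (L + μ) ^ 2 / (L ^ 2 * (L - μ))) = 1 + η * (L + μ) / 2 := by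
    field_simp
    ring
  refine exists_le_dist_iterate_of_discrim_neg hT (planarOsgm_fixed hμ hL) hTv
    (div_ne_zero (by positivity) (mul_ne_zero (by positivity) hsub)) ?_ ?_
  · rw [hdet]
    nlinarith
  · rw [hdet]
    linarith

end Planar

section Instability

variable {m : ℕ} {lam : Fin (m + 2) → ℝ} {L μ c d η : ℝ}

theorem osgmSystem_middle {s : ℝ × EuclideanSpace ℝ (Fin (m + 2))} {i : Fin (m + 2)}
    (hi : s.2 i = 0) : (osgmSystem lam η s).2 i = 0 := by
  simp [osgmSystem, direction, diagOp_apply, hi]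

/-- The normalizing factor cancels in the ratio of coordinates; the two nonvanishing conditions keep
the last coordinate nonzero before and after the step. -/
theorem planarOsgm_semiconj (hL : L = lam 0) (hμ : μ = lam (Fin.last (m + 1)))
    {s : ℝ × EuclideanSpace ℝ (Fin (m + 2))}
    (hs : ∀ i, i ≠ 0 → i ≠ Fin.last (m + 1) → s.2 i = 0) (hn : s.2 (Fin.last (m + 1)) ≠ 0)
    (hα : 1 - s.1 * μ ≠ 0) :
    ((osgmSystem lam η s).1,
        ((osgmSystem lam η s).2 0 / (osgmSystem lam η s).2 (Fin.last (m + 1))) ^ 2) =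
      planarOsgm L μ η (s.1, (s.2 0 / s.2 (Fin.last (m + 1))) ^ 2) := by
  have hz : s.2 = EuclideanSpace.single 0 (s.2 0) +
      EuclideanSpace.single (Fin.last (m + 1)) (s.2 (Fin.last (m + 1))) := by
    ext i
    by_cases hi0 : i = 0
    · rw [hi0, extremal_zero]
    · by_cases hin : i = Fin.last (m + 1)
      · rw [hin, extremal_last]
      · rw [extremal_middle hi0 hin, hs i hi0 hin]
  have hinner (k : ℕ) : inner ℝ s.2 ((diagOp lam ^ k) s.2) =
      L ^ k * s.2 0 * s.2 0 + μ ^ k * s.2 (Fin.last (m + 1)) * s.2 (Fin.last (m + 1)) := by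
    conv_lhs => rw [hz]
    rw [inner_extremal_diagOp_pow hL hμ, extremal_zero, extremal_last]
  have hw : s.2 - s.1 • diagOp lam s.2 ≠ 0 := by
    intro h0
    have := congrArg (fun x : EuclideanSpace ℝ (Fin (m + 2)) => x (Fin.last (m + 1))) h0
    simp only [PiLp.sub_apply, PiLp.smul_apply, diagOp_apply, ← hμ, smul_eq_mul,
      PiLp.zero_apply] at this
    have h1 : (1 - s.1 * μ) * s.2 (Fin.last (m + 1)) = 0 := by linarith
    exact mul_ne_zero hα hn h1
  have hκ : ‖s.2 - s.1 • diagOp lam s.2‖⁻¹ ≠ 0 := inv_ne_zero (norm_ne_zero_iff.2 hw)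
  have hcoord (i : Fin (m + 2)) : (osgmSystem lam η s).2 i =
      ‖s.2 - s.1 • diagOp lam s.2‖⁻¹ * ((1 - s.1 * lam i) * s.2 i) := by
    simp [osgmSystem, direction, diagOp_apply]
    left
    ring
  refine Prod.ext ?_ ?_
  · simp only [osgmSystem, stepsizeUpdate, planarOsgm, hinner]
    congr 2
    have hpos : 0 < s.2 (Fin.last (m + 1)) ^ 2 := by positivity
    have hfactor (k : ℕ) : L ^ k * s.2 0 * s.2 0 +
        μ ^ k * s.2 (Fin.last (m + 1)) * s.2 (Fin.last (m + 1)) =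
        (L ^ k * (s.2 0 / s.2 (Fin.last (m + 1))) ^ 2 + μ ^ k) *
          s.2 (Fin.last (m + 1)) ^ 2 := by
      field_simp
    rw [hfactor, hfactor, mul_div_mul_right _ _ hpos.ne']
  · simp only [planarOsgm]
    rw [hcoord, hcoord, mul_div_mul_left _ _ hκ, ← hL, ← hμ, mul_div_mul_comm]
    ring

/-- Squaring the ratio sends both orbit points to the same `P`. Stability would keep a trajectory
where the semiconjugacy is valid and its image within `ε` of `P` forever, contradicting expulsion
from `P`. -/
theorem not_lyapunovStableOn_osgmSystem (h : IsExtremalPair L μ c d) (hL : L = lam 0)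
    (hμ : μ = lam (Fin.last (m + 1))) (hη : 0 < η) (hηL : η ≤ 1 / L) :
    ¬ LyapunovStableOn (osgmSystem lam η) (stateSpace (m + 2))
      {extremalState m L μ c d, extremalState m L μ (-c) d} := by
  intro hstab
  have h0 := h.add_pos
  have hsub := sub_pos.2 h.lt
  have hL0 : L ≠ 0 := (h.pos.trans h.lt).ne'
  obtain ⟨ε, hε, hesc⟩ := exists_le_dist_iterate_planarOsgm h.pos h.lt hη hηL
  set P : ℝ × ℝ := (2 / (L + μ), μ ^ 2 / L ^ 2) with hP
  let π : ℝ × EuclideanSpace ℝ (Fin (m + 2)) → ℝ × ℝ :=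
    fun s => (s.1, (s.2 0 / s.2 (Fin.last (m + 1))) ^ 2)
  have hπ {c' : ℝ} (h' : IsExtremalPair L μ c' d) : π (extremalState m L μ c' d) = P := by
    simp only [π, extremalState, extremal_zero, extremal_last, hP]
    congr 1
    rw [div_pow, div_eq_div_iff (pow_ne_zero 2 h'.right_ne_zero) (pow_ne_zero 2 hL0)]
    linarith [h'.ratio]
  have hnear {c' : ℝ} (h' : IsExtremalPair L μ c' d) : ∀ᶠ s in 𝓝 (extremalState m L μ c' d),
      dist (π s) P < ε ∧ s.2 (Fin.last (m + 1)) ≠ 0 ∧ 1 - s.1 * μ ≠ 0 := by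
    have hlast : (extremalState m L μ c' d).2 (Fin.last (m + 1)) ≠ 0 := by
      rw [extremalState, extremal_last]
      exact h'.right_ne_zero
    have hcoord (i : Fin (m + 2)) :
        Continuous fun s : ℝ × EuclideanSpace ℝ (Fin (m + 2)) => s.2 i := by fun_prop
    have hcont : ContinuousAt π (extremalState m L μ c' d) :=
      continuousAt_fst.prodMk
        (((hcoord 0).continuousAt.div (hcoord _).continuousAt hlast).pow 2)
    have hα : 1 - (extremalState m L μ c' d).1 * μ ≠ 0 := by
      have : 1 - 2 / (L + μ) * μ = (L - μ) / (L + μ) := by field_simp; ring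
      rw [extremalState, this]
      positivity
    have hαc : Continuous fun s : ℝ × EuclideanSpace ℝ (Fin (m + 2)) => 1 - s.1 * μ := by fun_prop
    have h1 := Metric.tendsto_nhds.1 hcont ε hε
    rw [hπ h'] at h1
    exact h1.and (((hcoord _).continuousAt.eventually_ne hlast).and
      (hαc.continuousAt.eventually_ne hα))
  obtain ⟨δ₁, hδ₁, hb₁⟩ := Metric.eventually_nhds_iff.1 (hnear h)
  obtain ⟨δ₂, hδ₂, hb₂⟩ := Metric.eventually_nhds_iff.1 (hnear h.neg_left)
  obtain ⟨r, hr, hrs⟩ := hstab (min δ₁ δ₂) (lt_min hδ₁ hδ₂)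
  -- Perturbing only the stepsize stays on the sphere and in the invariant plane, while moving the
  -- projection off `P`.
  let s₀ : ℝ × EuclideanSpace ℝ (Fin (m + 2)) :=
    (2 / (L + μ) + r / 2, (extremalState m L μ c d).2)
  have hs₀ : s₀ ∈ stateSpace (m + 2) := norm_extremal h.sq_add_sq
  have hdist : Metric.infDist s₀ {extremalState m L μ c d, extremalState m L μ (-c) d} < r := by
    refine (Metric.infDist_le_dist_of_mem (Set.mem_insert _ _)).trans_lt ?_
    rw [Prod.dist_eq]
    simp only [s₀, extremalState, dist_self, Real.dist_eq, add_sub_cancel_left]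
    rw [abs_of_pos (by positivity), max_lt_iff]
    constructor <;> linarith
  have hgood (k : ℕ) : dist (π ((osgmSystem lam η)^[k] s₀)) P < ε ∧
      ((osgmSystem lam η)^[k] s₀).2 (Fin.last (m + 1)) ≠ 0 ∧
      1 - ((osgmSystem lam η)^[k] s₀).1 * μ ≠ 0 := by
    rcases (Metric.infDist_lt_iff ⟨_, Set.mem_insert _ _⟩).1 (hrs s₀ hs₀ hdist k) with
      ⟨y, hy | hy, hxy⟩
    · rw [hy, lt_min_iff] at hxy
      exact hb₁ hxy.1
    · rw [Set.mem_singleton_iff] at hy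
      rw [hy, lt_min_iff] at hxy
      exact hb₂ hxy.2
  have hmid (k : ℕ) (i : Fin (m + 2)) (hi0 : i ≠ 0) (hin : i ≠ Fin.last (m + 1)) :
      ((osgmSystem lam η)^[k] s₀).2 i = 0 := by
    induction k with
    | zero => exact extremal_middle hi0 hin
    | succ k ih =>
      rw [Function.iterate_succ_apply']
      exact osgmSystem_middle ih
  have hconj (k : ℕ) : π ((osgmSystem lam η)^[k] s₀) = (planarOsgm L μ η)^[k] (π s₀) := by
    induction k with
    | zero => rfl
    | succ k ih =>
      rw [Function.iterate_succ_apply', Function.iterate_succ_apply', ← ih]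
      exact planarOsgm_semiconj hL hμ (hmid k) (hgood k).2.1 (hgood k).2.2
  have hne : π s₀ ≠ P := by
    intro heq
    have := congrArg Prod.fst heq
    simp only [π, s₀, hP] at this
    linarith
  obtain ⟨k, hk⟩ := hesc (π s₀) hne
  rw [← hconj] at hk
  exact absurd (hgood k).1 (not_lt.2 hk)

end Instability

/-! ### Assembly of the four claims. -/

theorem mainTheorem3
    (m : ℕ) (A Q : Matrix (Fin (m + 2)) (Fin (m + 2)) ℝ) (lam : Fin (m + 2) → ℝ)
    (hA : A.PosDef)
    (hQ : Q ∈ Matrix.orthogonalGroup (Fin (m + 2)) ℝ)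
    (hdecomp : A = Q * Matrix.diagonal lam * Qᵀ)
    (hlam : StrictAnti lam)
    (L μ κ η γ δ : ℝ)
    (hL : L = lam 0) (hμ : μ = lam (Fin.last (m + 1))) (hκ : κ = L / μ)
    (hη : 0 < η) (hηL : η ≤ 1 / L)
    (hγ : γ = μ / Real.sqrt (L ^ 2 + μ ^ 2))
    (hδ : δ = L / Real.sqrt (L ^ 2 + μ ^ 2) ∨ δ = -(L / Real.sqrt (L ^ 2 + μ ^ 2)))
    (s₁ s₂ : ℝ × EuclideanSpace ℝ (Fin (m + 2)))
    (hs₁ : s₁ = extremalState m L μ γ δ) (hs₂ : s₂ = extremalState m L μ (-γ) δ) :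
    -- the systems are the normalized dynamics of the two algorithms on the quadratic
    (∀ (α : ℝ) (x : EuclideanSpace ℝ (Fin (m + 2))), x ≠ 0 →
      normalizedState Q (hdmStep (quadObjective A) η (α, x)) =
          hdmSystem lam η (normalizedState Q (α, x)) ∧
        normalizedState Q (osgmStep (quadObjective A) η (α, x)) =
          osgmSystem lam η (normalizedState Q (α, x))) ∧
    -- common orbit of period two
    (s₁ ∈ stateSpace (m + 2) ∧ s₂ ∈ stateSpace (m + 2) ∧ s₁ ≠ s₂ ∧
      hdmSystem lam η s₁ = s₂ ∧ hdmSystem lam η s₂ = s₁ ∧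
      osgmSystem lam η s₁ = s₂ ∧ osgmSystem lam η s₂ = s₁) ∧
    -- the Jacobians along the orbit exist
    (DifferentiableAt ℝ (hdmSystem lam η) s₁ ∧ DifferentiableAt ℝ (hdmSystem lam η) s₂ ∧
      DifferentiableAt ℝ (osgmSystem lam η) s₁ ∧ DifferentiableAt ℝ (osgmSystem lam η) s₂) ∧
    -- spectral radii of the products of the Jacobians
    realSpectralRadius
      (jacobianMatrix (hdmSystem lam η) s₁ * jacobianMatrix (hdmSystem lam η) s₂) < 1 ∧
    1 < realSpectralRadius
      (jacobianMatrix (osgmSystem lam η) s₁ * jacobianMatrix (osgmSystem lam η) s₂) ∧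
    realSpectralRadius
      (jacobianMatrix (osgmSystem lam η) s₁ * jacobianMatrix (osgmSystem lam η) s₂) =
        ENNReal.ofReal (1 + η * (L + μ) / 2) ∧
    (η = 1 / L → realSpectralRadius
      (jacobianMatrix (osgmSystem lam η) s₁ * jacobianMatrix (osgmSystem lam η) s₂) =
        ENNReal.ofReal ((3 * κ + 1) / (2 * κ))) ∧
    -- the orbit is stable for Classic-HDM and unstable for OSGM-H
    AsymptoticallyStableOn (hdmSystem lam η) (stateSpace (m + 2)) {s₁, s₂} ∧
    ¬ LyapunovStableOn (osgmSystem lam η) (stateSpace (m + 2)) {s₁, s₂} := by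
  have hpos := eigenvalue_pos_of_posDef hA hQ hdecomp
  have hμ0 : 0 < μ := hμ ▸ hpos _
  have hlt : μ < L := by
    rw [hμ, hL]
    exact hlam Fin.last_pos
  have hL0 : 0 < L := hμ0.trans hlt
  have hsq : 0 < L ^ 2 + μ ^ 2 := by positivity
  have h : IsExtremalPair L μ γ δ := by
    refine ⟨hμ0, hlt, ?_, ?_⟩
    · rw [hγ, div_pow, Real.sq_sqrt hsq.le, div_mul_cancel₀ _ hsq.ne']
    · rcases hδ with hδ | hδ
      · rw [hδ, div_pow, Real.sq_sqrt hsq.le, div_mul_cancel₀ _ hsq.ne']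
      · rw [hδ, neg_sq, div_pow, Real.sq_sqrt hsq.le, div_mul_cancel₀ _ hsq.ne']
  have hρ := realSpectralRadius_osgmSystem h hL hμ hlam hη hηL
  subst hs₁ hs₂
  refine ⟨fun α x hx => normalizedState_step hA hQ hdecomp η α hx,
    ⟨norm_extremal h.sq_add_sq, norm_extremal h.neg_left.sq_add_sq, fun heq => ?_,
      hdmSystem_extremalState h hL hμ η, ?_, osgmSystem_extremalState h hL hμ η, ?_⟩,
    ⟨?_, ?_, ?_, ?_⟩, realSpectralRadius_hdmSystem_lt_one h hL hμ hlam hη hηL, ?_, hρ,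
    fun hηe => ?_, asymptoticallyStableOn_hdmSystem h hL hμ hlam hη hηL,
    not_lyapunovStableOn_osgmSystem h hL hμ hη hηL⟩
  · have h0 := congrArg (fun s : ℝ × EuclideanSpace ℝ (Fin (m + 2)) => s.2 0) heq
    simp only [extremalState, extremal_zero] at h0
    exact h.left_ne_zero (by linarith)
  · rw [hdmSystem_extremalState h.neg_left hL hμ η, neg_neg]
  · rw [osgmSystem_extremalState h.neg_left hL hμ η, neg_neg]
  · obtain ⟨T, hT, -⟩ := exists_hasFDerivAt_hdmSystem h hL hμ η
    exact hT.differentiableAt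
  · obtain ⟨T, hT, -⟩ := exists_hasFDerivAt_hdmSystem h.neg_left hL hμ η
    exact hT.differentiableAt
  · obtain ⟨T, hT, -⟩ := exists_hasFDerivAt_osgmSystem h hL hμ η
    exact hT.differentiableAt
  · obtain ⟨T, hT, -⟩ := exists_hasFDerivAt_osgmSystem h.neg_left hL hμ η
    exact hT.differentiableAt
  · rw [hρ, ENNReal.one_lt_ofReal]
    have := mul_pos hη h.add_pos
    linarith
  · rw [hρ, hηe, hκ]
    congr 1
    field_simp
    ring
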